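/- Let $\zeta\in\mathbb C$ be a primitive seventh root of unity, let $K=\mathbb{Q}(\zeta+\zeta^{-1})$, and let $\mathcal{O}_K$ be its ring of algebraic integers. An element $a\in K$ is called totally positive if $\sigma(a)>0$ for every field embedding $\sigma:K\to\mathbb{R}$. A quadratic form $Q(x_1,\dots,x_d)$ with coefficients in $\mathcal{O}_K$ is called universal over $K$ if $Q(x)$ is totally positive for every nonzero $x\in K^d$ and, for every totally positive $a\in\mathcal{O}_K$, the equation $Q(x)=a$ has a solution $x\in\mathcal{O}_K^d$. Then: 1. The quadratic form $Q(x,y,z,w)=x^2+xy+y^2+yz-xw+z^2+zw+w^2$ is universal over $K$. 2. The quadratic form $F(x,y,z,w)=x^2+y^2+z^2+w^2+xy+xz+xw$ is universal over $K$. 3. The forms are equivalent over $\mathcal{O}_K$: the map $(x,y,z,w)\mapsto(2x+y-w,\,-x,\,-x+z+w,\,-x+w)$ is a bijection of $\mathcal{O}_K^4$ onto itself, and $F(2x+y-w,\,-x,\,-x+z+w,\,-x+w)=Q(x,y,z,w)$ for all $x,y,z,w\in\mathcal{O}_K$. 4. Let $i,j,k$ be the standard basis elements of Hamilton's real quaternions.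 Set $A=B=\mu=\nu=1$, $S=4A-\mu^2=3$, $T=BS-\nu^2=2$, $\alpha=\frac{\mu+i\sqrt{S}}{2}$ and $\beta=\frac{\nu i+j\sqrt{T}}{\sqrt{S}}$. For every embedding $\sigma$ of $K$ into $\mathbb{R}$, through which $K$ is regarded as a subfield of $\mathbb{R}$, the set $$H=\{x+y\alpha+z\beta+w\alpha\beta : x,y,z,w\in\mathcal{O}_K\}$$ is a subring of the real quaternions without zero divisors, and every left ideal and every right ideal of $H$ is principal. -/

import Mathlib

open scoped NumberField Quaternion IntermediateField

namespace UniversalForm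

/-- An element of a totally real number field `K` is totally positive if every
real embedding of `K` sends it to a positive real number. -/
def TotallyPositive {K : Type*} [Field K] (a : K) : Prop :=
  ∀ σ : K →+* ℝ, 0 < σ a

/-- A quadratic form in `d` variables with coefficients in the ring of integers of `K`, given as a
homogeneous polynomial of degree two, is totally positive definite over `K` if it takes totally
positive values at all nonzero vectors with coordinates in `K`. -/
def TotallyPositiveDefinite {K : Type*} [Field K] {d : ℕ} (Q : MvPolynomial (Fin d) (𝓞 K)) :
    Prop :=
  ∀ x : Fin d → K, x ≠ 0 → TotallyPositive (MvPolynomial.aeval x Q)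

/-- `Q` represents `a` if `Q(x) = a` has a solution in algebraic integers of `K`. -/
def Represents {K : Type*} [Field K] {d : ℕ} (Q : MvPolynomial (Fin d) (𝓞 K)) (a : 𝓞 K) : Prop :=
  ∃ x : Fin d → 𝓞 K, MvPolynomial.eval x Q = a

/-- A universal form over `K`: a totally positive definite quadratic form over the ring of integers
that represents every totally positive algebraic integer of `K`. -/
def IsUniversal {K : Type*} [Field K] {d : ℕ} (Q : MvPolynomial (Fin d) (𝓞 K)) : Prop :=
  Q.IsHomogeneous 2 ∧ TotallyPositiveDefinite Q ∧
    ∀ a : 𝓞 K, TotallyPositive (a : K) → Represents Q a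

section Forms

open MvPolynomial

/-- The form `x² + xy + y² + yz - xw + z² + zw + w²`
in the variables `(x, y, z, w) = (X 0, X 1, X 2, X 3)`. -/
noncomputable def quaternionForm (R : Type*) [CommRing R] : MvPolynomial (Fin 4) R :=
  X 0 ^ 2 + X 0 * X 1 + X 1 ^ 2 + X 1 * X 2 - X 0 * X 3 + X 2 ^ 2 + X 2 * X 3 + X 3 ^ 2

/-- The form `x² + y² + z² + w² + xy + xz + xw`
in the variables `(x, y, z, w) = (X 0, X 1, X 2, X 3)`. -/
noncomputable def hurwitzForm (R : Type*) [CommRing R] : MvPolynomial (Fin 4) R :=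
  X 0 ^ 2 + X 1 ^ 2 + X 2 ^ 2 + X 3 ^ 2 + X 0 * X 1 + X 0 * X 2 + X 0 * X 3

end Forms

/-- `α = (μ + i√S) / 2`, where `S = 4A - μ²`. -/
noncomputable def alpha (A μ : ℝ) : ℍ[ℝ] :=
  ⟨μ / 2, √(4 * A - μ ^ 2) / 2, 0, 0⟩

/-- `β = (νi + j√T) / √S`, where `S = 4A - μ²` and `T = BS - ν²`. -/
noncomputable def beta (A B μ ν : ℝ) : ℍ[ℝ] :=
  ⟨0, ν / √(4 * A - μ ^ 2), √(B * (4 * A - μ ^ 2) - ν ^ 2) / √(4 * A - μ ^ 2), 0⟩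

/-- The set `{x + yα + zβ + wαβ : x, y, z, w ∈ 𝓞 K}` of real quaternions attached to
`A, B, μ, ν ∈ 𝓞 K`, where `K` is regarded as a subfield of `ℝ` through the embedding `σ`. -/
def quaternionSet {K : Type*} [Field K] (σ : K →+* ℝ) (A B μ ν : 𝓞 K) : Set ℍ[ℝ] :=
  {L | ∃ x y z w : 𝓞 K,
    L = ((σ x : ℝ) : ℍ[ℝ]) + ((σ y : ℝ) : ℍ[ℝ]) * alpha (σ A) (σ μ)
      + ((σ z : ℝ) : ℍ[ℝ]) * beta (σ A) (σ B) (σ μ) (σ ν)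
      + ((σ w : ℝ) : ℍ[ℝ]) * (alpha (σ A) (σ μ) * beta (σ A) (σ B) (σ μ) (σ ν))}

/-- A set `H` of real quaternions is a (noncommutative) principal ideal domain: it is a subring
without zero divisors in which every left ideal and every right ideal is principal. -/
def IsQuaternionPID (H : Set ℍ[ℝ]) : Prop :=
  ∃ R : Subring ℍ[ℝ], (R : Set ℍ[ℝ]) = H ∧ IsDomain R ∧
    IsPrincipalIdealRing R ∧ IsPrincipalIdealRing Rᵐᵒᵖ

end UniversalForm

/-! The form `Q` is the reduced norm of the Hurwitz order `H` over `𝓞 K`, with `α = (1+i+j+k)/2` and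
`β = j`, so everything rests on `H` having only principal one-sided ideals.

In a nonzero left ideal `I` take a nonzero `b` of least absolute norm. Then `M = I b⁻¹` contains `H`
and has no nonzero element of absolute norm below 1; the claim is `M = H`. By AM-GM, distinct points
of `M` lie at squared distance at least 3 in `ℝ¹²`, so Blichfeldt's packing bound leaves fewer than
169 = 13² classes modulo `H` (`card_lt_of_incongruent`). Suppose `m ∈ M` and `p m ∈ H` for a prime
`p`. If 13 scalars have differences invertible modulo `p`, then the 169 combinations `f m + f' g m`
cannot all be incongruent unless `m ∈ H`, so otherwise each `g ∈ H` acts on `m` as a scalar. Then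
`i` and `j` commute on `m`, and `ij - ji = 2k` gives `2m ∈ H`, hence `m ∈ H`. This settles `p ≥ 13`
and the inert primes 3, 5, 11. At 2 and 7 the residue fields have only 8 and 7 elements; there
explicit elements of absolute norm below 1 give the contradiction.

For universality, a prime `p` of `𝓞 K` divides some `a² + b² + 1`, and a generator of the left ideal
`(a + bi + j, p)` has norm associated to `p`. As `𝓞 K` is a UFD, every element is a norm up to a
unit. Units of all signatures exist, so totally positive units are squares and can be absorbed. Part
4 transports `H` into the real quaternions; conjugation exchanges left and right ideals. -/

/-- The data presenting a field `K` as the cubic field generated by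
`η = 2 cos (2π/7)`, with a Galois automorphism and a real embedding. -/
structure HeptagonalField (K : Type*) [Field K] [CharZero K] where
  η : K
  root : η ^ 3 + η ^ 2 - 2 * η - 1 = 0
  span : ∀ x : K, ∃ a b c : ℚ, x = a + b * η + c * η ^ 2
  conj : K →+* K
  conj_η : conj η = η ^ 2 - 2
  toReal : K →+* ℝ

/-! ### Norm, trace and integrality in the cubic field -/

namespace HeptagonalField

variable {K : Type*} [Field K] [NumberField K] (D : HeptagonalField K)

/-- The norm form of `ℤ[η]` in the basis `1, η, η²`. -/
def cubicNorm {R : Type*} [CommRing R] (a b c : R) : R :=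
  a ^ 3 - a ^ 2 * b + 5 * a ^ 2 * c - 2 * a * b ^ 2 - a * b * c + 6 * a * c ^ 2
    + b ^ 3 - b ^ 2 * c - 2 * b * c ^ 2 + c ^ 3

theorem conj_conj_η : D.conj (D.conj D.η) = 1 - D.η - D.η ^ 2 := by
  rw [conj_η, map_sub, map_pow, conj_η, map_ofNat]
  linear_combination (D.η - 1) * D.root

theorem conj_rat (a b c : ℚ) : D.conj (a + b * D.η + c * D.η ^ 2) =
    a + b * (D.η ^ 2 - 2) + c * (D.η ^ 2 - 2) ^ 2 := by
  simp [conj_η]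

theorem conj_conj_rat (a b c : ℚ) : D.conj (D.conj (a + b * D.η + c * D.η ^ 2)) =
    a + b * (1 - D.η - D.η ^ 2) + c * (1 - D.η - D.η ^ 2) ^ 2 := by
  simp [conj_conj_η]

theorem norm_rat (a b c : ℚ) :
    (a + b * D.η + c * D.η ^ 2) * D.conj (a + b * D.η + c * D.η ^ 2) *
      D.conj (D.conj (a + b * D.η + c * D.η ^ 2)) = ((cubicNorm a b c : ℚ) : K) := by
  rw [conj_conj_rat, conj_rat, cubicNorm]
  push_cast
  have h := D.root
  generalize D.η = t at *
  generalize (a : K) = a, (b : K) = b, (c : K) = c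
  -- The cofactor is the quotient on division by `t³ + t² - 2t - 1`.
  linear_combination (t ^ 7 * c ^ 3 + b * c ^ 2 * t ^ 6 + c ^ 3 * t ^ 6 + a * c ^ 2 * t ^ 5 + b * c ^ 2 * t ^ 5
    - 4 * c ^ 3 * t ^ 5 + a * c ^ 2 * t ^ 4 - 3 * b * c ^ 2 * t ^ 4 - 3 * c ^ 3 * t ^ 4
    - 2 * a * c ^ 2 * t ^ 3 - 2 * b * c ^ 2 * t ^ 3 + 5 * c ^ 3 * t ^ 3 + 3 * a * b * c * t ^ 2
    - 3 * a * c ^ 2 * t ^ 2 - b ^ 3 * t ^ 2 + b ^ 2 * c * t ^ 2 + 4 * b * c ^ 2 * t ^ 2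
    + c ^ 3 * t ^ 2 + 2 * a ^ 2 * c * t - a * b ^ 2 * t + a * b * c * t + 4 * a * c ^ 2 * t
    - 2 * c ^ 3 * t - 3 * a * b * c + 2 * a * c ^ 2 + b ^ 3 - b ^ 2 * c - 2 * b * c ^ 2 + c ^ 3) * h

theorem trace_rat (a b c : ℚ) :
    (a + b * D.η + c * D.η ^ 2) + D.conj (a + b * D.η + c * D.η ^ 2) +
      D.conj (D.conj (a + b * D.η + c * D.η ^ 2)) = ((3 * a - b + 5 * c : ℚ) : K) := by
  rw [conj_conj_rat, conj_rat]
  push_cast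
  linear_combination (2 * c * D.η : K) * D.root

/-- The three real embeddings of `K`. -/
noncomputable def emb : Fin 3 → K →+* ℝ :=
  ![D.toReal, D.toReal.comp D.conj, D.toReal.comp (D.conj.comp D.conj)]

theorem prod_emb (x : K) : ∏ k, D.emb k x = D.toReal (x * D.conj x * D.conj (D.conj x)) := by
  simp [Fin.prod_univ_three, emb]

theorem exists_int_of_isIntegral_ratCast {q : ℚ} (h : IsIntegral ℤ (q : K)) :
    ∃ n : ℤ, (n : ℚ) = q := by
  have h' : IsIntegral ℤ (algebraMap ℚ K q) := by simpa using h
  rw [isIntegral_algebraMap_iff (algebraMap ℚ K).injective] at h'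
  simpa using IsIntegrallyClosed.isIntegral_iff.1 h'

theorem isIntegral_η : IsIntegral ℤ D.η := by
  refine ⟨Polynomial.X ^ 3 + Polynomial.X ^ 2 - 2 * Polynomial.X - 1, ?_, ?_⟩
  · monicity!
  · simpa using D.root

theorem exists_int_trace {a b c : ℚ} (h : IsIntegral ℤ (a + b * D.η + c * D.η ^ 2)) :
    ∃ n : ℤ, (n : ℚ) = 3 * a - b + 5 * c := by
  refine exists_int_of_isIntegral_ratCast (K := K) ?_
  rw [← D.trace_rat]
  exact (h.add (map_isIntegral_int D.conj h)).add
    (map_isIntegral_int D.conj (map_isIntegral_int D.conj h))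

theorem exists_int_norm {a b c : ℚ} (h : IsIntegral ℤ (a + b * D.η + c * D.η ^ 2)) :
    ∃ n : ℤ, (n : ℚ) = cubicNorm a b c := by
  refine exists_int_of_isIntegral_ratCast (K := K) ?_
  rw [← D.norm_rat]
  exact (h.mul (map_isIntegral_int D.conj h)).mul
    (map_isIntegral_int D.conj (map_isIntegral_int D.conj h))

/-- Rewritten in powers of `π = η - 2`, whose minimal polynomial is Eisenstein at 7, the norm of `A
+ Bπ + cπ²` has pure terms `A³ - 7B³ + 49c³`. Successive reduction yields `7 ∣ A`, `7 ∣ B`, `7 ∣ c`.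
-/
theorem seven_dvd_of_dvd_cubicNorm {a b c : ℤ} (h : 343 ∣ cubicNorm a b c) :
    7 ∣ a ∧ 7 ∣ b ∧ 7 ∣ c := by
  obtain ⟨A, rfl⟩ : ∃ A, a = A - 2 * b - 4 * c := ⟨a + 2 * b + 4 * c, by ring⟩
  obtain ⟨B, rfl⟩ : ∃ B, b = B - 4 * c := ⟨b + 4 * c, by ring⟩
  have p7 : Prime (7 : ℤ) := by norm_num
  obtain ⟨n, hn⟩ := h
  unfold cubicNorm at hn
  obtain ⟨A, rfl⟩ : 7 ∣ A := p7.dvd_of_dvd_pow (n := 3)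
    ⟨49 * n + A ^ 2 * B - 3 * A ^ 2 * c - 2 * A * B ^ 2 + 11 * A * B * c - 14 * A * c ^ 2 + B ^ 3
      - 7 * B ^ 2 * c + 14 * B * c ^ 2 - 7 * c ^ 3, by linear_combination hn⟩
  obtain ⟨B, rfl⟩ : 7 ∣ B := p7.dvd_of_dvd_pow (n := 3)
    ⟨7 * A ^ 3 - 7 * A ^ 2 * B + 21 * A ^ 2 * c + 2 * A * B ^ 2 - 11 * A * B * c + 14 * A * c ^ 2
      + B ^ 2 * c - 2 * B * c ^ 2 + c ^ 3 - 7 * n, by linarith⟩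
  obtain ⟨c, rfl⟩ : 7 ∣ c := p7.dvd_of_dvd_pow (n := 3)
    ⟨n - A ^ 3 + 7 * A ^ 2 * B - 3 * A ^ 2 * c - 14 * A * B ^ 2 + 11 * A * B * c - 2 * A * c ^ 2
      + 7 * B ^ 3 - 7 * B ^ 2 * c + 2 * B * c ^ 2, by linarith⟩
  omega

/-- The traces of `x`, `xη`, `xη²` are integers and the trace form has determinant 49, so `49x ∈
ℤ[η]`. The norm of `49x` is divisible by `7⁶`, which removes the two factors 7. -/
theorem exists_int_of_isIntegral {x : K} (h : IsIntegral ℤ x) :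
    ∃ a b c : ℤ, x = a + b * D.η + c * D.η ^ 2 := by
  obtain ⟨a, b, c, rfl⟩ := D.span x
  have e1 : (a + b * D.η + c * D.η ^ 2 : K) * D.η =
      ((c : ℚ) : K) + ((a + 2 * c : ℚ) : K) * D.η + ((b - c : ℚ) : K) * D.η ^ 2 := by
    push_cast
    linear_combination (c : K) * D.root
  have h1 := h.mul D.isIntegral_η
  rw [e1] at h1
  have e2 : (((c : ℚ) : K) + ((a + 2 * c : ℚ) : K) * D.η + ((b - c : ℚ) : K) * D.η ^ 2) * D.η =
      ((b - c : ℚ) : K) + ((2 * b - c : ℚ) : K) * D.η + ((a - b + 3 * c : ℚ) : K) * D.η ^ 2 := by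
    push_cast
    linear_combination (b - c : K) * D.root
  have h2 := h1.mul D.isIntegral_η
  rw [e2] at h2
  obtain ⟨t0, h0⟩ := D.exists_int_trace h
  obtain ⟨t1, h1⟩ := D.exists_int_trace h1
  obtain ⟨t2, h2⟩ := D.exists_int_trace h2
  obtain ⟨n, hn⟩ := D.exists_int_norm h
  -- The coefficients are the rows of the adjugate of the trace matrix.
  obtain ⟨A, hA⟩ : ∃ A : ℤ, (A : ℚ) = 49 * a := ⟨49 * t0 - 7 * t1 - 21 * t2, by push_cast; rw [h0, h1, h2]; ring⟩
  obtain ⟨B, hB⟩ : ∃ B : ℤ, (B : ℚ) = 49 * b := ⟨-7 * t0 + 14 * t1 + 7 * t2, by push_cast; rw [h0, h1, h2]; ring⟩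
  obtain ⟨C, hC⟩ : ∃ C : ℤ, (C : ℚ) = 49 * c := ⟨-21 * t0 + 7 * t1 + 14 * t2, by push_cast; rw [h0, h1, h2]; ring⟩
  have hN : 343 * (343 * n) = cubicNorm A B C := by
    have hn' : (n : ℚ) = cubicNorm a b c := hn
    have : (343 * (343 * n) : ℚ) = cubicNorm (A : ℚ) B C := by
      rw [hA, hB, hC, hn']; unfold cubicNorm; ring
    unfold cubicNorm at this ⊢
    exact_mod_cast this
  obtain ⟨⟨A, rfl⟩, ⟨B, rfl⟩, ⟨C, rfl⟩⟩ := seven_dvd_of_dvd_cubicNorm ⟨_, hN.symm⟩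
  have hN' : 343 * n = cubicNorm A B C := by
    unfold cubicNorm at hN ⊢
    linarith
  obtain ⟨⟨A, rfl⟩, ⟨B, rfl⟩, ⟨C, rfl⟩⟩ := seven_dvd_of_dvd_cubicNorm ⟨_, hN'.symm⟩
  refine ⟨A, B, C, ?_⟩
  push_cast at hA hB hC
  rw [show a = A by linarith, show b = B by linarith, show c = C by linarith]
  simp


/-! ### The ring of integers -/

/-- `η` as an algebraic integer. -/
def intη : 𝓞 K := ⟨D.η, D.isIntegral_η⟩

@[simp]
theorem coe_intη : (D.intη : K) = D.η := rfl

theorem intη_root : D.intη ^ 3 + D.intη ^ 2 - 2 * D.intη - 1 = 0 := by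
  apply NumberField.RingOfIntegers.ext
  simpa only [map_sub, map_add, map_mul, map_pow, map_one, map_zero, map_ofNat,
    coe_intη] using D.root

theorem exists_int (x : 𝓞 K) : ∃ a b c : ℤ, x = a + b * D.intη + c * D.intη ^ 2 := by
  obtain ⟨a, b, c, h⟩ := D.exists_int_of_isIntegral x.isIntegral_coe
  exact ⟨a, b, c, NumberField.RingOfIntegers.ext (by simpa using h)⟩

/-- The product of the two nontrivial conjugates of `a + b η + c η²`. -/
theorem exists_mul_eq_cubicNorm (a b c : ℤ) :
    ∃ y : 𝓞 K, (a + b * D.intη + c * D.intη ^ 2) * y = (cubicNorm a b c : ℤ) := by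
  have h := D.intη_root
  generalize D.intη = t at *
  refine ⟨(a + b * (t ^ 2 - 2) + c * (t ^ 2 - 2) ^ 2) *
    (a + b * (1 - t - t ^ 2) + c * (1 - t - t ^ 2) ^ 2), ?_⟩
  unfold cubicNorm
  push_cast
  generalize (a : 𝓞 K) = a, (b : 𝓞 K) = b, (c : 𝓞 K) = c
  linear_combination (t ^ 7 * c ^ 3 + b * c ^ 2 * t ^ 6 + c ^ 3 * t ^ 6 + a * c ^ 2 * t ^ 5 + b * c ^ 2 * t ^ 5
    - 4 * c ^ 3 * t ^ 5 + a * c ^ 2 * t ^ 4 - 3 * b * c ^ 2 * t ^ 4 - 3 * c ^ 3 * t ^ 4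
    - 2 * a * c ^ 2 * t ^ 3 - 2 * b * c ^ 2 * t ^ 3 + 5 * c ^ 3 * t ^ 3 + 3 * a * b * c * t ^ 2
    - 3 * a * c ^ 2 * t ^ 2 - b ^ 3 * t ^ 2 + b ^ 2 * c * t ^ 2 + 4 * b * c ^ 2 * t ^ 2
    + c ^ 3 * t ^ 2 + 2 * a ^ 2 * c * t - a * b ^ 2 * t + a * b * c * t + 4 * a * c ^ 2 * t
    - 2 * c ^ 3 * t - 3 * a * b * c + 2 * a * c ^ 2 + b ^ 3 - b ^ 2 * c - 2 * b * c ^ 2 + c ^ 3) * h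

theorem prod_emb_int (a b c : ℤ) :
    ∏ k, D.emb k (a + b * D.η + c * D.η ^ 2) = (cubicNorm a b c : ℤ) := by
  have := D.norm_rat a b c
  rw [prod_emb]
  simp only [Rat.cast_intCast] at this
  rw [this, map_ratCast]
  simp [cubicNorm]

theorem exists_int_prod_emb (x : 𝓞 K) : ∃ n : ℤ, ∏ k, D.emb k x = n := by
  obtain ⟨a, b, c, h⟩ := D.exists_int_of_isIntegral x.isIntegral_coe
  exact ⟨_, (congrArg (fun y => ∏ k, D.emb k y) h).trans (D.prod_emb_int a b c)⟩

/-- The Vandermonde determinant of the three conjugates of `η`. -/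
theorem vandermonde_η : (D.η - (D.η ^ 2 - 2)) * ((D.η ^ 2 - 2) - (1 - D.η - D.η ^ 2)) *
    ((1 - D.η - D.η ^ 2) - D.η) = -7 := by
  linear_combination (2 * D.η ^ 3 + D.η ^ 2 - 9 * D.η - 1) * D.root

/-- Conjugating the relation gives a Vandermonde system of determinant `-7`. -/
theorem eq_zero_of_rat {a b c : ℚ} (h : a + b * D.η + c * D.η ^ 2 = 0) :
    a = 0 ∧ b = 0 ∧ c = 0 := by
  have h1 := D.conj_rat a b c
  have h2 := D.conj_conj_rat a b c
  rw [h, map_zero] at h1 h2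
  rw [map_zero] at h2
  have hV := D.vandermonde_η
  have hc : (c : K) * -7 = 0 := by
    rw [← hV]
    generalize D.η = t at *
    linear_combination (-((t ^ 2 - 2) - (1 - t - t ^ 2))) * h + ((1 - t - t ^ 2) - t) * h1 + (t - (t ^ 2 - 2)) * h2
  have hc' : c = 0 := by simpa using hc
  subst hc'
  have hb : (b : K) * -7 = 0 := by
    rw [← hV]
    linear_combination (((D.η ^ 2 - 2) - (1 - D.η - D.η ^ 2)) * ((1 - D.η - D.η ^ 2) - D.η)) * (h + h1)
  have hb' : b = 0 := by simpa using hb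
  subst hb'
  simpa using h

end HeptagonalField

/-! ### Integral basis, discriminant 49, class number one -/

namespace HeptagonalField
variable {K : Type*} [Field K] [NumberField K] (D : HeptagonalField K)

theorem linearIndependent_int :
    LinearIndependent ℤ ![(1 : 𝓞 K), D.intη, D.intη ^ 2] := by
  rw [Fintype.linearIndependent_iff]
  intro g hg
  have h : ((g 0 : ℚ) : K) + ((g 1 : ℚ) : K) * D.η + ((g 2 : ℚ) : K) * D.η ^ 2 = 0 := by
    have := congrArg (algebraMap (𝓞 K) K) hg
    simpa [Fin.sum_univ_three] using this
  obtain ⟨h0, h1, h2⟩ := D.eq_zero_of_rat h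
  intro i
  fin_cases i
  · exact_mod_cast h0
  · exact_mod_cast h1
  · exact_mod_cast h2

/-- The integral basis `1, η, η²` of the ring of integers. -/
noncomputable def intBasis : Module.Basis (Fin 3) ℤ (𝓞 K) :=
  .mk D.linearIndependent_int fun x _ => by
    obtain ⟨a, b, c, rfl⟩ := D.exists_int x
    rw [Submodule.mem_span_range_iff_exists_fun]
    exact ⟨![a, b, c], by simp [Fin.sum_univ_three]⟩

theorem intBasis_zero : D.intBasis 0 = 1 := by simp [intBasis]
theorem intBasis_one : D.intBasis 1 = D.intη := by simp [intBasis]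
theorem intBasis_two : D.intBasis 2 = D.intη ^ 2 := by simp [intBasis]

include D in
theorem finrank_eq : Module.finrank ℚ K = 3 := by
  rw [← NumberField.RingOfIntegers.rank K, Module.finrank_eq_card_basis D.intBasis, Fintype.card_fin]

theorem repr_int (a b c : ℤ) :
    D.intBasis.repr (a + b * D.intη + c * D.intη ^ 2) = Finsupp.equivFunOnFinite.symm ![a, b, c] := by
  have : (a + b * D.intη + c * D.intη ^ 2 : 𝓞 K) = ∑ i, ![a, b, c] i • D.intBasis i := by
    simp [Fin.sum_univ_three, intBasis_zero, intBasis_one, intBasis_two]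
  ext i
  rw [this, Module.Basis.repr_sum_self]
  rfl

theorem trace_int (a b c : ℤ) :
    Algebra.trace ℤ (𝓞 K) (a + b * D.intη + c * D.intη ^ 2) = 3 * a - b + 5 * c := by
  have e0 : (a + b * D.intη + c * D.intη ^ 2) * D.intBasis 0 =
      a + b * D.intη + c * D.intη ^ 2 := by rw [intBasis_zero, mul_one]
  have e1 : (a + b * D.intη + c * D.intη ^ 2) * D.intBasis 1 =
      (c : ℤ) + (a + 2 * c : ℤ) * D.intη + (b - c : ℤ) * D.intη ^ 2 := by
    rw [intBasis_one]
    push_cast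
    linear_combination (c : 𝓞 K) * D.intη_root
  have e2 : (a + b * D.intη + c * D.intη ^ 2) * D.intBasis 2 =
      (b - c : ℤ) + (2 * b - c : ℤ) * D.intη + (a - b + 3 * c : ℤ) * D.intη ^ 2 := by
    rw [intBasis_two]
    push_cast
    linear_combination ((c : 𝓞 K) * D.intη + b - c) * D.intη_root
  rw [Algebra.trace_eq_matrix_trace D.intBasis, Matrix.trace, Fin.sum_univ_three]
  simp only [Matrix.diag_apply, Algebra.leftMulMatrix_eq_repr_mul, e0, e1, e2, repr_int]
  simp
  ring

include D in
theorem discr_eq : NumberField.discr K = 49 := by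
  rw [← NumberField.discr_eq_discr K D.intBasis, Algebra.discr_def]
  have h : Algebra.traceMatrix ℤ D.intBasis = !![3, -1, 5; -1, 5, -4; 5, -4, 13] := by
    have key (x : 𝓞 K) (a b c n : ℤ) (hx : x = a + b * D.intη + c * D.intη ^ 2)
        (hn : 3 * a - b + 5 * c = n) : Algebra.trace ℤ (𝓞 K) x = n := by
      rw [hx, trace_int, hn]
    have hr := D.intη_root
    ext i j
    rw [Algebra.traceMatrix_apply, Algebra.traceForm_apply]
    fin_cases i <;> fin_cases j <;>
      simp only [Fin.zero_eta, Fin.mk_one, Fin.reduceFinMk, intBasis_zero, intBasis_one, intBasis_two]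
    · exact key _ 1 0 0 _ (by push_cast; ring) rfl
    · exact key _ 0 1 0 _ (by push_cast; ring) rfl
    · exact key _ 0 0 1 _ (by push_cast; ring) rfl
    · exact key _ 0 1 0 _ (by push_cast; ring) rfl
    · exact key _ 0 0 1 _ (by push_cast; ring) rfl
    · exact key _ 1 2 (-1) _ (by push_cast; linear_combination hr) rfl
    · exact key _ 0 0 1 _ (by push_cast; ring) rfl
    · exact key _ 1 2 (-1) _ (by push_cast; linear_combination hr) rfl
    · exact key _ (-1) (-1) 3 _ (by push_cast; linear_combination (D.intη - 1) * hr) rfl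
  rw [h, Matrix.det_fin_three]
  simp

include D in
theorem isPrincipalIdealRing_integers : IsPrincipalIdealRing (𝓞 K) := by
  apply RingOfIntegers.isPrincipalIdealRing_of_abs_discr_lt
  have h := NumberField.InfinitePlace.card_add_two_mul_card_eq_rank K
  rw [D.finrank_eq] at h
  rw [D.discr_eq, D.finrank_eq]
  -- Total reality is not needed: the bound on the discriminant is 81 with no complex place and `81
  -- (π/4)² ≈ 49.97` with one, both above 49.
  have hr : NumberField.InfinitePlace.nrComplexPlaces K ≤ 1 := by omega
  have hpi := Real.pi_gt_d2
  interval_cases NumberField.InfinitePlace.nrComplexPlaces K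
  · norm_num [Nat.factorial]
  · norm_num [Nat.factorial]
    nlinarith

/-! ### Signatures of units -/

/-- The signs of a unit at the three real places. -/
noncomputable def signs (u : (𝓞 K)ˣ) (k : Fin 3) : Bool := decide (0 < D.emb k u)

theorem emb_unit_ne_zero (u : (𝓞 K)ˣ) (k : Fin 3) : D.emb k u ≠ 0 := by
  simp

theorem signs_mul_sq (u v : (𝓞 K)ˣ) : D.signs (u * v ^ 2) = D.signs u := by
  funext k
  have : 0 < D.emb k v ^ 2 := by
    have := D.emb_unit_ne_zero v k
    positivity
  simp [signs, mul_pos_iff_of_pos_right this]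

theorem emb_η : D.emb 0 D.η = D.toReal D.η ∧ D.emb 1 D.η = D.toReal D.η ^ 2 - 2 ∧
    D.emb 2 D.η = 1 - D.toReal D.η - D.toReal D.η ^ 2 := by
  refine ⟨rfl, ?_, ?_⟩
  · simp [emb, conj_η, map_ofNat]
  · simp [emb, conj_conj_η]

theorem emb_η_root (k : Fin 3) : D.emb k D.η ^ 3 + D.emb k D.η ^ 2 - 2 * D.emb k D.η - 1 = 0 := by
  simpa only [map_sub, map_add, map_mul, map_pow, map_one, map_zero, map_ofNat]
    using congrArg (D.emb k) D.root

/-- The conjugates `r, s, t` of `η` are units with product 1 and sum `-1`, so exactly one is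
positive. The units `±1, ±η, ±η', ±η''` therefore realise all eight sign patterns. -/
theorem signs_surjective : Function.Surjective D.signs := by
  have hr := D.intη_root
  let a : (𝓞 K)ˣ := .mkOfMulEqOne D.intη (D.intη ^ 2 + D.intη - 2) (by linear_combination hr)
  let b : (𝓞 K)ˣ := .mkOfMulEqOne (D.intη ^ 2 - 2) (D.intη * (1 - D.intη - D.intη ^ 2))
    (by linear_combination (-D.intη ^ 2 + 1) * hr)
  let c : (𝓞 K)ˣ := .mkOfMulEqOne (1 - D.intη - D.intη ^ 2) (D.intη * (D.intη ^ 2 - 2))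
    (by linear_combination (-D.intη ^ 2 + 1) * hr)
  obtain ⟨h0, h1, h2⟩ := D.emb_η
  have root0 := D.emb_η_root 0
  rw [h0] at root0
  have ha (k) : D.emb k a = D.emb k D.η := rfl
  have hb (k) : D.emb k b = D.emb k D.η ^ 2 - 2 := by
    change D.emb k (algebraMap (𝓞 K) K (D.intη ^ 2 - 2)) = _
    simp only [map_sub, map_pow, map_ofNat, coe_intη]
  have hc (k) : D.emb k c = 1 - D.emb k D.η - D.emb k D.η ^ 2 := by
    change D.emb k (algebraMap (𝓞 K) K (1 - D.intη - D.intη ^ 2)) = _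
    simp only [map_sub, map_pow, map_one, coe_intη]
  generalize D.toReal D.η = r at *
  set s := r ^ 2 - 2 with hs
  set t := 1 - r - r ^ 2 with ht
  have hb0 : D.emb 0 b = s := by rw [hb, h0]
  have hb1 : D.emb 1 b = t := by rw [hb, h1]; linear_combination (r - 1) * root0
  have hb2 : D.emb 2 b = r := by rw [hb, h2]; linear_combination (r + 1) * root0
  have hc0 : D.emb 0 c = t := by rw [hc, h0]
  have hc1 : D.emb 1 c = r := by rw [hc, h1]; linear_combination (-r + 1) * root0
  have hc2 : D.emb 2 c = s := by rw [hc, h2]; linear_combination (-r - 1) * root0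
  have ha0 : D.emb 0 a = r := by rw [ha, h0]
  have ha1 : D.emb 1 a = s := by rw [ha, h1]
  have ha2 : D.emb 2 a = t := by rw [ha, h2]
  have hsum : r + s + t = -1 := by rw [hs, ht]; ring
  have hprod : r * s * t = 1 := by rw [hs, ht]; linear_combination (-r ^ 2 + 1) * root0
  clear_value s t a b c
  clear hs ht hr root0 h0 h1 h2 ha hb hc
  have hcases : (0 < r ∧ s < 0 ∧ t < 0) ∨ (r < 0 ∧ 0 < s ∧ t < 0) ∨ (r < 0 ∧ s < 0 ∧ 0 < t) := by
    have hr : r ≠ 0 := by rintro rfl; simp at hprod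
    have hs : s ≠ 0 := by rintro rfl; simp at hprod
    have ht : t ≠ 0 := by rintro rfl; simp at hprod
    rcases hr.lt_or_gt with hr | hr <;> rcases hs.lt_or_gt with hs | hs <;>
      rcases ht.lt_or_gt with ht | ht
    · have := mul_neg_of_pos_of_neg (mul_pos_of_neg_of_neg hr hs) ht
      linarith
    · tauto
    · tauto
    · have := mul_neg_of_neg_of_pos (mul_neg_of_neg_of_pos hr hs) ht
      linarith
    · tauto
    · have := mul_neg_of_neg_of_pos (mul_neg_of_pos_of_neg hr hs) ht
      linarith
    · have := mul_neg_of_pos_of_neg (mul_pos hr hs) ht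
      linarith
    · linarith
  have key (p : Fin 3 → Bool) (u : (𝓞 K)ˣ) (hu : ∀ k, decide (0 < D.emb k u) = p k) :
      ∃ u, D.signs u = p := ⟨u, funext hu⟩
  intro p
  rcases hp0 : p 0 <;> rcases hp1 : p 1 <;> rcases hp2 : p 2 <;>
    rcases hcases with ⟨hr, hs, ht⟩ | ⟨hr, hs, ht⟩ | ⟨hr, hs, ht⟩ <;>
    have hr' := hr.le <;> have hs' := hs.le <;> have ht' := ht.le <;>
    first
    | (refine key p 1 ?_; simp [Fin.forall_fin_succ, *]; done)
    | (refine key p (-1) ?_; simp [Fin.forall_fin_succ, *]; done)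
    | (refine key p a ?_; simp [Fin.forall_fin_succ, *]; done)
    | (refine key p b ?_; simp [Fin.forall_fin_succ, *]; done)
    | (refine key p c ?_; simp [Fin.forall_fin_succ, *]; done)
    | (refine key p (-a) ?_; simp [Fin.forall_fin_succ, *]; done)
    | (refine key p (-b) ?_; simp [Fin.forall_fin_succ, *]; done)
    | (refine key p (-c) ?_; simp [Fin.forall_fin_succ, *])

open NumberField.Units in
open scoped Classical in
-- By Dirichlet's theorem there are at most `2 · 2² = 8` classes of units modulo squares, and the
-- signature maps them onto 8 patterns. The map is thus injective on classes, and the trivial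
-- pattern is the class of squares.
theorem exists_sq_of_totallyPositive (u : (𝓞 K)ˣ) (hu : ∀ k, 0 < D.emb k u) :
    ∃ v : (𝓞 K)ˣ, u = v ^ 2 := by
  let T := Bool × (Fin (rank K) → Bool)
  let g : T → (𝓞 K)ˣ := fun t =>
    (if t.1 then -1 else 1) * ∏ i, fundSystem K i ^ (if t.2 i then (1 : ℤ) else 0)
  have hg (u : (𝓞 K)ˣ) : ∃ t v, u = g t * v ^ 2 := by
    obtain ⟨⟨z, e⟩, h, -⟩ := exist_unique_eq_mul_prod K u
    have hz := torsion_eq_one_or_neg_one_of_odd_finrank (by rw [D.finrank_eq]; decide) z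
    refine ⟨(decide ((z : (𝓞 K)ˣ) = -1), fun i => decide (e i % 2 = 1)),
      ∏ i, fundSystem K i ^ (e i / 2), ?_⟩
    have h1 : (z : (𝓞 K)ˣ) = if decide ((z : (𝓞 K)ˣ) = -1) then -1 else 1 := by
      have hne : (1 : (𝓞 K)ˣ) ≠ -1 := by
        intro h
        have := congrArg (fun u : (𝓞 K)ˣ => (u : 𝓞 K)) h
        norm_num at this
      rcases hz with hz | hz <;> simp [hz, hne]
    dsimp only [g]
    rw [← h1, ← Finset.prod_pow, mul_assoc, ← Finset.prod_mul_distrib]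
    rw [h]
    congr 1
    refine Finset.prod_congr rfl fun i _ => ?_
    rw [← zpow_natCast, ← zpow_mul, ← zpow_add]
    congr 1
    have := Int.emod_two_eq_zero_or_one (e i)
    simp only [decide_eq_true_eq]
    push_cast
    split_ifs <;> omega
  have hsurj : Function.Surjective fun t => D.signs (g t) := by
    intro p
    obtain ⟨u, rfl⟩ := D.signs_surjective p
    obtain ⟨t, v, rfl⟩ := hg u
    exact ⟨t, (D.signs_mul_sq _ _).symm⟩
  have hcard : Fintype.card T ≤ Fintype.card (Fin 3 → Bool) := by
    have hrank : rank K ≤ 2 := by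
      have h1 := NumberField.InfinitePlace.card_add_two_mul_card_eq_rank K
      have h2 := NumberField.InfinitePlace.card_eq_nrRealPlaces_add_nrComplexPlaces K
      rw [D.finrank_eq] at h1
      unfold rank
      omega
    have : 2 ^ rank K ≤ 2 ^ 2 := Nat.pow_le_pow_right two_pos hrank
    simp [T]
    omega
  have hinj := ((Fintype.bijective_iff_surjective_and_card _).2
    ⟨hsurj, le_antisymm hcard (Fintype.card_le_of_surjective _ hsurj)⟩).1
  obtain ⟨t, v, rfl⟩ := hg u
  have h1 : t = (false, fun _ => false) := by
    apply hinj
    funext k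
    have h2 := congrFun (D.signs_mul_sq (g t) v) k
    change D.signs (g t) k = D.signs (g _) k
    rw [← h2, signs, decide_eq_true (hu k)]
    simp [signs, g]
  exact ⟨v, by simp [h1, g]⟩

end HeptagonalField

/-! ### Blichfeldt's packing bound in dimension 12 -/

section Packing
open MeasureTheory Module

/-- Blichfeldt's inequality: at most a bounded weight of points with pairwise distance at least
`√3` can be close to the origin. -/
theorem sum_max_le_of_separated {ι E : Type*} [NormedAddCommGroup E]
    [InnerProductSpace ℝ E] (s : Finset ι) (y : ι → E)
    (h : ∀ i ∈ s, ∀ j ∈ s, i ≠ j → 3 ≤ ‖y i - y j‖ ^ 2) :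
    ∑ i ∈ s, max (3 / 2 - ‖y i‖ ^ 2) 0 ≤ 3 / 2 := by
  classical
  -- Only these points carry weight. If there are `n ≥ 1`, the pairwise distances force `∑ ‖y i‖² ≥
  -- 3(n-1)/2`, so the total weight is at most `3n/2 - 3(n-1)/2`.
  set t := s.filter fun i => ‖y i‖ ^ 2 < 3 / 2 with ht
  have h1 : ∑ i ∈ s, max (3 / 2 - ‖y i‖ ^ 2) 0 = ∑ i ∈ t, (3 / 2 - ‖y i‖ ^ 2) := by
    rw [ht, Finset.sum_filter]
    refine Finset.sum_congr rfl fun i _ => ?_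
    split_ifs with hi
    · exact max_eq_left (by linarith)
    · exact max_eq_right (by linarith)
  rw [h1]
  rcases t.eq_empty_or_nonempty with h0 | h0
  · rw [h0]; norm_num
  have hk : (1 : ℝ) ≤ t.card := by exact_mod_cast h0.card_pos
  have h2 : ∑ i ∈ t, ∑ j ∈ t, ‖y i - y j‖ ^ 2 =
      2 * t.card * ∑ i ∈ t, ‖y i‖ ^ 2 - 2 * ‖∑ i ∈ t, y i‖ ^ 2 := by
    have : ∀ i j, ‖y i - y j‖ ^ 2 = ‖y i‖ ^ 2 + ‖y j‖ ^ 2 - 2 * inner ℝ (y i) (y j) := by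
      intro i j
      rw [norm_sub_sq_real]; ring
    simp_rw [this, Finset.sum_sub_distrib, Finset.sum_add_distrib, ← Finset.mul_sum, ← inner_sum,
      ← sum_inner, Finset.sum_const, real_inner_self_eq_norm_sq, nsmul_eq_mul]
    rw [← Finset.mul_sum]
    ring
  have h3 : (3 : ℝ) * (t.card * (t.card - 1)) ≤ ∑ i ∈ t, ∑ j ∈ t, ‖y i - y j‖ ^ 2 := by
    have : ∀ i ∈ t, (3 : ℝ) * (t.card - 1) ≤ ∑ j ∈ t, ‖y i - y j‖ ^ 2 := by
      intro i hi
      rw [← Finset.add_sum_erase t _ hi]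
      have h4 : ∑ j ∈ t.erase i, (3 : ℝ) ≤ ∑ j ∈ t.erase i, ‖y i - y j‖ ^ 2 :=
        Finset.sum_le_sum fun j hj => h i (Finset.mem_filter.1 hi).1 j
          (Finset.mem_filter.1 (Finset.mem_of_mem_erase hj)).1 (Finset.ne_of_mem_erase hj).symm
      rw [Finset.sum_const, Finset.card_erase_of_mem hi, nsmul_eq_mul,
        Nat.cast_pred h0.card_pos] at h4
      have := sq_nonneg ‖y i - y i‖
      linarith
    have := Finset.sum_le_sum this
    rw [Finset.sum_const, nsmul_eq_mul] at this
    linarith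
  rw [Finset.sum_sub_distrib, Finset.sum_const, nsmul_eq_mul]
  have h5 : 0 ≤ ‖∑ i ∈ t, y i‖ ^ 2 := by positivity
  have h6 : (3 / 2 * (t.card - 1) : ℝ) * t.card ≤ (∑ i ∈ t, ‖y i‖ ^ 2) * t.card := by linarith
  have := le_of_mul_le_mul_right h6 (by linarith)
  linarith

/-- In polar coordinates this is 12 times the unit ball volume `π⁶/720` times `∫ r¹¹ (3/2 - r²) dr`
over `[0, √(3/2)]`. -/
theorem lintegral_weight {E : Type*} [NormedAddCommGroup E] [InnerProductSpace ℝ E]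
    [FiniteDimensional ℝ E] [MeasurableSpace E] [BorelSpace E] (hE : finrank ℝ E = 12) :
    ∫⁻ x : E, ENNReal.ofReal (max (3 / 2 - ‖x‖ ^ 2) 0) =
      ENNReal.ofReal (Real.pi ^ 6 / 720 * ((3 / 2) ^ 7 / 7)) := by
  have : Nontrivial E := Module.nontrivial_of_finrank_pos (R := ℝ) (by omega)
  set c := √(3 / 2 : ℝ) with hc
  have hc2 : c ^ 2 = 3 / 2 := Real.sq_sqrt (by norm_num)
  have hc0 : 0 ≤ c := Real.sqrt_nonneg _
  have hcont : Continuous fun x : E => max (3 / 2 - ‖x‖ ^ 2) 0 := by fun_prop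
  have hsupp : HasCompactSupport fun x : E => max (3 / 2 - ‖x‖ ^ 2) 0 := by
    refine HasCompactSupport.intro (isCompact_closedBall (0 : E) c) fun x hx => ?_
    rw [mem_closedBall_zero_iff, not_le] at hx
    exact max_eq_right (by nlinarith)
  rw [← ofReal_integral_eq_lintegral_ofReal (hcont.integrable_of_hasCompactSupport hsupp)
    (.of_forall fun x => le_max_right _ _)]
  congr 1
  rw [integral_fun_norm_addHaar volume fun r : ℝ => max (3 / 2 - r ^ 2) 0, hE]
  have h1 : ∫ y in Set.Ioi (0 : ℝ), y ^ (12 - 1) • max (3 / 2 - y ^ 2) 0 =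
      ∫ y in (0 : ℝ)..c, (3 / 2 * y ^ 11 - y ^ 13) := by
    rw [intervalIntegral.integral_of_le hc0,
      setIntegral_eq_of_subset_of_forall_sdiff_eq_zero measurableSet_Ioi
        (show Set.Ioc 0 c ⊆ Set.Ioi 0 from fun _ h => h.1)]
    · refine setIntegral_congr_fun measurableSet_Ioc fun y hy => ?_
      have : max (3 / 2 - y ^ 2) 0 = 3 / 2 - y ^ 2 := max_eq_left (by nlinarith [hy.1, hy.2])
      simp only [this, smul_eq_mul]
      ring
    · rintro y ⟨hy0, hy⟩
      have hy' : c < y := not_le.1 fun h => hy ⟨hy0, h⟩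
      rw [max_eq_right (by nlinarith), smul_zero]
  have h2 : ∫ y in (0 : ℝ)..c, (3 / 2 * y ^ 11 - y ^ 13) = (3 / 2) ^ 7 / 84 := by
    rw [intervalIntegral.integral_sub (Continuous.intervalIntegrable (by fun_prop) _ _)
      (Continuous.intervalIntegrable (by fun_prop) _ _)]
    simp only [intervalIntegral.integral_const_mul, integral_pow]
    have h12 : c ^ 12 = (3 / 2) ^ 6 := by rw [← hc2]; ring
    have h14 : c ^ 14 = (3 / 2) ^ 7 := by rw [← hc2]; ring
    norm_num [h12, h14]
  have hball : volume.real (Metric.ball (0 : E) 1) = Real.pi ^ 6 / 720 := by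
    rw [Measure.real, InnerProductSpace.volume_ball_of_dim_even (k := 6) (by rw [hE])]
    simp [Nat.factorial]
    positivity
  rw [h1, h2, hball]
  simp
  ring

/-- Centre the weight at every lattice translate of every point of `s`. The total is at most `3/2`
everywhere; integrating over a fundamental domain unfolds each point's share to the integral over
all of `E`. -/
theorem card_mul_le_of_separated {ι E : Type*} [NormedAddCommGroup E] [InnerProductSpace ℝ E]
    [MeasurableSpace E] [BorelSpace E] [Finite ι] (b : Basis ι ℝ E) (hE : finrank ℝ E = 12)
    (s : Finset E)
    (h : ∀ x ∈ s, ∀ y ∈ s, ∀ l ∈ Submodule.span ℤ (Set.range b), x ≠ y ∨ l ≠ 0 →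
      3 ≤ ‖x - y + l‖ ^ 2) [FiniteDimensional ℝ E] :
    s.card * (Real.pi ^ 6 / 720 * ((3 / 2) ^ 7 / 7)) ≤
      3 / 2 * volume.real (ZSpan.fundamentalDomain b) := by
  have hF := ZSpan.isAddFundamentalDomain' b (volume : Measure E)
  set L := (Submodule.span ℤ (Set.range b)).toAddSubgroup
  have : Countable L := by
    change Countable (Submodule.span ℤ (Set.range b))
    infer_instance
  let g : E → ENNReal := fun x => ENNReal.ofReal (max (3 / 2 - ‖x‖ ^ 2) 0)
  have hg : Measurable g := by fun_prop
  have h1 (x : E) : ∫⁻ y : E, g y = ∑' l : L, ∫⁻ y in ZSpan.fundamentalDomain b, g (l + y - x) := by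
    rw [← lintegral_sub_right_eq_self g x, hF.lintegral_eq_tsum'']
    rfl
  have h2 : s.card * ∫⁻ y : E, g y ≤
      ∫⁻ y in ZSpan.fundamentalDomain b, ENNReal.ofReal (3 / 2) := by
    calc s.card * ∫⁻ y : E, g y
        = ∑ x ∈ s, ∑' l : L, ∫⁻ y in ZSpan.fundamentalDomain b, g (l + y - x) := by
          simp_rw [← h1, Finset.sum_const, nsmul_eq_mul]
      _ = ∫⁻ y in ZSpan.fundamentalDomain b, ∑ x ∈ s, ∑' l : L, g (l + y - x) := by
          rw [lintegral_finsetSum']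
          · refine Finset.sum_congr rfl fun x _ => (lintegral_tsum fun l => ?_).symm
            fun_prop
          · intro x _
            refine Measurable.aemeasurable ?_
            refine Measurable.tsum fun l => ?_
            fun_prop
      _ ≤ _ := by
          refine lintegral_mono fun y => ?_
          rw [← Summable.tsum_finsetSum fun x _ => ENNReal.summable]
          rw [ENNReal.tsum_eq_iSup_sum]
          refine iSup_le fun t => ?_
          have key := sum_max_le_of_separated (t ×ˢ s) (fun p => (p.1 + y - p.2 : E)) (by
            rintro ⟨l, x⟩ hx ⟨l', x'⟩ hx' hne
            rw [Finset.mem_product] at hx hx'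
            have := h x' hx'.2 x hx.2 (l - l' : E) (sub_mem l.2 l'.2) (by
              by_contra! hc
              obtain ⟨hc1, hc2⟩ := hc
              exact hne (Prod.ext (Subtype.ext (sub_eq_zero.1 hc2)) hc1.symm))
            convert this using 3
            abel)
          rw [Finset.sum_product] at key
          simp_rw [g, ← ENNReal.ofReal_sum_of_nonneg fun _ _ => le_max_right _ (0 : ℝ)]
          rw [← ENNReal.ofReal_sum_of_nonneg fun _ _ => Finset.sum_nonneg fun _ _ => le_max_right _ _]
          exact ENNReal.ofReal_le_ofReal key
  rw [lintegral_weight hE, setLIntegral_const] at h2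
  have hfin : volume (ZSpan.fundamentalDomain b) ≠ ⊤ :=
    (ZSpan.fundamentalDomain_isBounded b).measure_lt_top.ne
  have h3 := ENNReal.toReal_mono (ENNReal.mul_ne_top ENNReal.ofReal_ne_top hfin) h2
  rw [ENNReal.toReal_mul, ENNReal.toReal_mul, ENNReal.toReal_ofReal (by positivity),
    ENNReal.toReal_ofReal (by norm_num), ENNReal.toReal_natCast] at h3
  exact h3

end Packing

/-! ### The Hurwitz order over the ring of integers -/

/-- The quaternion `a + bi + cj + dk`. -/
def quat {R : Type*} [CommRing R] (a b c d : R) : ℍ[R] := ⟨a, b, c, d⟩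

section

variable {R : Type*} [CommRing R] (a b c d : R)

@[simp] theorem re_quat : (quat a b c d).re = a := rfl
@[simp] theorem imI_quat : (quat a b c d).imI = b := rfl
@[simp] theorem imJ_quat : (quat a b c d).imJ = c := rfl
@[simp] theorem imK_quat : (quat a b c d).imK = d := rfl

end

/-- The Hurwitz quaternion `x + yα + zβ + wαβ`, where `α = (1 + i + j + k) / 2` and `β = j`. -/
def hurwitzMk {K : Type*} [Field K] (x y z w : 𝓞 K) : ℍ[K] :=
  ⟨x + (y - w) / 2, (y - w) / 2, z + (y + w) / 2, (y + w) / 2⟩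

section

variable {K : Type*} [Field K]

@[simp] theorem re_hurwitzMk (x y z w : 𝓞 K) : (hurwitzMk x y z w).re = x + (y - w) / 2 := rfl
@[simp] theorem imI_hurwitzMk (x y z w : 𝓞 K) : (hurwitzMk x y z w).imI = (y - w) / 2 := rfl
@[simp] theorem imJ_hurwitzMk (x y z w : 𝓞 K) : (hurwitzMk x y z w).imJ = z + (y + w) / 2 := rfl
@[simp] theorem imK_hurwitzMk (x y z w : 𝓞 K) : (hurwitzMk x y z w).imK = (y + w) / 2 := rfl

theorem smul_quat (x a b c d : K) : x • quat a b c d = quat (x * a) (x * b) (x * c) (x * d) := by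
  ext <;> simp

theorem quat_add (a b c d a' b' c' d' : K) :
    quat a b c d + quat a' b' c' d' = quat (a + a') (b + b') (c + c') (d + d') := by
  ext <;> simp

theorem quat_sub (a b c d a' b' c' d' : K) :
    quat a b c d - quat a' b' c' d' = quat (a - a') (b - b') (c - c') (d - d') := by
  ext <;> simp

theorem quat_mul (a b c d a' b' c' d' : K) : quat a b c d * quat a' b' c' d' =
    quat (a * a' - b * b' - c * c' - d * d') (a * b' + b * a' + c * d' - d * c')
      (a * c' - b * d' + c * a' + d * b') (a * d' + b * c' - c * b' + d * a') := by
  ext <;> simp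

theorem normSq_quat (a b c d : K) :
    Quaternion.normSq (quat a b c d) = a ^ 2 + b ^ 2 + c ^ 2 + d ^ 2 := by
  simp [Quaternion.normSq_def']

theorem hurwitzMk_coe (x : 𝓞 K) : hurwitzMk x 0 0 0 = ((x : K) : ℍ[K]) := by
  ext <;> simp

variable [CharZero K]

theorem hurwitzMk_add (x y z w x' y' z' w' : 𝓞 K) : hurwitzMk x y z w + hurwitzMk x' y' z' w' =
    hurwitzMk (x + x') (y + y') (z + z') (w + w') := by
  ext <;> simp <;> ring

theorem neg_hurwitzMk (x y z w : 𝓞 K) : -hurwitzMk x y z w = hurwitzMk (-x) (-y) (-z) (-w) := by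
  ext <;> simp <;> ring

theorem hurwitzMk_mul (x y z w x' y' z' w' : 𝓞 K) : hurwitzMk x y z w * hurwitzMk x' y' z' w' =
    hurwitzMk (x * x' - z * z' - y' * z - w' * z - y * y' - w * w')
      (x * y' + y * y' - w * y' + x' * y + w' * z - w * z')
      (x * z' + x' * z + y' * z - w' * z - w' * y + w * y')
      (w' * x + w' * y - w * w' + y * z' - y' * z + w * x') := by
  ext <;> simp <;> ring

theorem star_hurwitzMk (x y z w : 𝓞 K) :
    star (hurwitzMk x y z w) = hurwitzMk (x + y - w) (-y) (-z) (-w) := by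
  ext <;> simp <;> ring

theorem smul_hurwitzMk (a x y z w : 𝓞 K) :
    (a : K) • hurwitzMk x y z w = hurwitzMk (a * x) (a * y) (a * z) (a * w) := by
  ext <;> simp [Algebra.smul_def] <;> ring

theorem normSq_hurwitzMk (x y z w : 𝓞 K) : Quaternion.normSq (hurwitzMk x y z w) =
    (x ^ 2 + x * y + y ^ 2 + y * z - x * w + z ^ 2 + z * w + w ^ 2 : 𝓞 K) := by
  simp [Quaternion.normSq_def']
  ring

variable (K) in
/-- The Hurwitz order over the ring of integers of `K`. -/
def hurwitzOrder : Subring ℍ[K] where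
  carrier := {q | ∃ x y z w, q = hurwitzMk x y z w}
  mul_mem' := by
    rintro _ _ ⟨x, y, z, w, rfl⟩ ⟨x', y', z', w', rfl⟩
    exact ⟨_, _, _, _, hurwitzMk_mul ..⟩
  add_mem' := by
    rintro _ _ ⟨x, y, z, w, rfl⟩ ⟨x', y', z', w', rfl⟩
    exact ⟨_, _, _, _, hurwitzMk_add ..⟩
  neg_mem' := by
    rintro _ ⟨x, y, z, w, rfl⟩
    exact ⟨_, _, _, _, neg_hurwitzMk ..⟩
  one_mem' := ⟨1, 0, 0, 0, by rw [hurwitzMk_coe]; simp⟩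
  zero_mem' := ⟨0, 0, 0, 0, by rw [hurwitzMk_coe]; simp⟩

theorem hurwitzMk_mem (x y z w : 𝓞 K) : hurwitzMk x y z w ∈ hurwitzOrder K := ⟨_, _, _, _, rfl⟩

theorem coe_mem_hurwitzOrder (x : 𝓞 K) : ((x : K) : ℍ[K]) ∈ hurwitzOrder K :=
  ⟨_, _, _, _, (hurwitzMk_coe x).symm⟩

theorem smul_mem_hurwitzOrder (x : 𝓞 K) {q : ℍ[K]} (hq : q ∈ hurwitzOrder K) :
    (x : K) • q ∈ hurwitzOrder K := by
  rw [← Quaternion.coe_mul_eq_smul]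
  exact mul_mem (coe_mem_hurwitzOrder x) hq

theorem star_mem_hurwitzOrder {q : ℍ[K]} (hq : q ∈ hurwitzOrder K) : star q ∈ hurwitzOrder K := by
  obtain ⟨x, y, z, w, rfl⟩ := hq
  exact ⟨_, _, _, _, star_hurwitzMk ..⟩

theorem exists_normSq_eq {q : ℍ[K]} (hq : q ∈ hurwitzOrder K) :
    ∃ n : 𝓞 K, Quaternion.normSq q = n := by
  obtain ⟨x, y, z, w, rfl⟩ := hq
  exact ⟨_, normSq_hurwitzMk ..⟩

theorem quat_mem_hurwitzOrder (x y z w : 𝓞 K) : quat (x : K) y z w ∈ hurwitzOrder K :=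
  ⟨x - y, y + w, z - w, w - y, by ext <;> simp <;> ring⟩

end

/-! ### The Hurwitz order as a lattice in dimension 12 -/

namespace HeptagonalField
open Module MeasureTheory
variable {K : Type*} [Field K] [NumberField K] (D : HeptagonalField K)

/-- The absolute norm of the reduced norm of a quaternion over `K`. -/
noncomputable def absNorm (q : ℍ[K]) : ℝ := ∏ k, D.emb k (Quaternion.normSq q)

theorem absNorm_mul (p q : ℍ[K]) : D.absNorm (p * q) = D.absNorm p * D.absNorm q := by
  simp [absNorm, Finset.prod_mul_distrib]

theorem emb_normSq_nonneg (k : Fin 3) (q : ℍ[K]) : 0 ≤ D.emb k (Quaternion.normSq q) := by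
  rw [Quaternion.normSq_def']
  simp only [map_add, map_pow]
  positivity

theorem toReal_normSq_pos (σ : K →+* ℝ) {q : ℍ[K]} (hq : q ≠ 0) : 0 < σ (Quaternion.normSq q) := by
  rw [Quaternion.normSq_def']
  simp only [map_add, map_pow]
  have h : q.re ≠ 0 ∨ q.imI ≠ 0 ∨ q.imJ ≠ 0 ∨ q.imK ≠ 0 := by
    by_contra! h
    exact hq (Quaternion.ext _ _ h.1 h.2.1 h.2.2.1 h.2.2.2)
  have key {x : K} (hx : x ≠ 0) : 0 < σ x ^ 2 := by
    have : σ x ≠ 0 := by simpa using hx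
    positivity
  rcases h with h | h | h | h <;> have := key h <;> positivity

theorem absNorm_pos {q : ℍ[K]} (hq : q ≠ 0) : 0 < D.absNorm q :=
  Finset.prod_pos fun _ _ => toReal_normSq_pos _ hq

/-- AM-GM for the three conjugates of the reduced norm; it turns a norm bound into a Euclidean
distance bound. -/
theorem three_le_sum_of_one_le_absNorm {q : ℍ[K]} (hq : 1 ≤ D.absNorm q) :
    3 ≤ ∑ k, D.emb k (Quaternion.normSq q) := by
  have h0 := D.emb_normSq_nonneg 0 q
  have h1 := D.emb_normSq_nonneg 1 q
  have h2 := D.emb_normSq_nonneg 2 q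
  rw [absNorm, Fin.prod_univ_three] at hq
  rw [Fin.sum_univ_three]
  generalize D.emb 0 _ = x at *
  generalize D.emb 1 _ = y at *
  generalize D.emb 2 _ = z at *
  by_contra! h
  have h3 : 27 * (x * y * z) ≤ (x + y + z) ^ 3 := by
    nlinarith [mul_nonneg h0 (sq_nonneg (y - z)), mul_nonneg h1 (sq_nonneg (x - z)),
      mul_nonneg h2 (sq_nonneg (x - y)), mul_nonneg h0 (sq_nonneg (x - y)),
      mul_nonneg h0 (sq_nonneg (x - z)), mul_nonneg h1 (sq_nonneg (x - y)),
      mul_nonneg h1 (sq_nonneg (y - z)), mul_nonneg h2 (sq_nonneg (x - z)),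
      mul_nonneg h2 (sq_nonneg (y - z))]
  have h4 : (x + y + z) ^ 3 < 3 ^ 3 := pow_lt_pow_left₀ h (by positivity) (by norm_num)
  linarith

/-- The coordinates of a quaternion. -/
def coords {R : Type*} [CommRing R] (q : ℍ[R]) : Fin 4 → R := ![q.re, q.imI, q.imJ, q.imK]

/-- The embedding of the quaternions over `K` in a Euclidean space of dimension `12`. -/
noncomputable def euclid : ℍ[K] →+ EuclideanSpace ℝ (Fin 3 × Fin 4) where
  toFun q := WithLp.toLp 2 fun p => D.emb p.1 (coords q p.2)
  map_zero' := by
    ext ⟨k, l⟩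
    fin_cases l <;> simp [coords]
  map_add' p q := by
    ext ⟨k, l⟩
    fin_cases l <;> simp [coords]

theorem norm_euclid_sq (q : ℍ[K]) : ‖D.euclid q‖ ^ 2 = ∑ k, D.emb k (Quaternion.normSq q) := by
  rw [EuclideanSpace.norm_sq_eq, Fintype.sum_prod_type]
  refine Finset.sum_congr rfl fun k _ => ?_
  simp [euclid, coords, Fin.sum_univ_four, Quaternion.normSq_def', add_assoc]

open scoped Kronecker

/-- The matrix of the embedding in the integral basis of the Hurwitz order. -/
noncomputable def euclidMatrix : Matrix (Fin 3 × Fin 4) (Fin 3 × Fin 4) ℝ :=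
  (Matrix.of fun k s : Fin 3 => D.emb k D.η ^ (s : ℕ)) ⊗ₖ
    !![1, 1 / 2, 0, -1 / 2; 0, 1 / 2, 0, -1 / 2; 0, 1 / 2, 1, 1 / 2; 0, 1 / 2, 0, 1 / 2]

/-- The Kronecker factors have determinants `-7` and `1/2`, giving `(-7)⁴ (1/2)³`. -/
theorem det_euclidMatrix : D.euclidMatrix.det = 2401 / 8 := by
  have h1 : (Matrix.of fun k s : Fin 3 => D.emb k D.η ^ (s : ℕ)).det = -7 := by
    obtain ⟨h0, h1, h2⟩ := D.emb_η
    have h := D.emb_η_root 0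
    rw [Matrix.det_fin_three]
    simp [h0, h1, h2] at h ⊢
    linear_combination (2 * D.toReal D.η ^ 3 + D.toReal D.η ^ 2 - 9 * D.toReal D.η - 1) * h
  rw [euclidMatrix, Matrix.det_kronecker, h1]
  simp [Matrix.det_succ_row_zero, Fin.sum_univ_succ]
  norm_num [Fin.succAbove]

theorem toMatrix_euclidMatrix : (EuclideanSpace.basisFun (Fin 3 × Fin 4) ℝ).toBasis.toMatrix
    (fun p => WithLp.toLp 2 fun i => D.euclidMatrix i p) = D.euclidMatrix := by
  ext i p
  simp [Basis.toMatrix_apply]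

/-- The image of the integral basis of the Hurwitz order. -/
noncomputable def euclidBasis : Basis (Fin 3 × Fin 4) ℝ (EuclideanSpace ℝ (Fin 3 × Fin 4)) :=
  have h := ((EuclideanSpace.basisFun (Fin 3 × Fin 4) ℝ).toBasis.is_basis_iff_det
    (v := fun p => WithLp.toLp 2 fun i => D.euclidMatrix i p)).2 (by
      rw [Basis.det_apply, toMatrix_euclidMatrix, det_euclidMatrix]
      norm_num)
  .mk h.1 h.2.ge

theorem coe_euclidBasis :
    ⇑D.euclidBasis = fun p => WithLp.toLp 2 fun i => D.euclidMatrix i p := by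
  rw [euclidBasis, Basis.coe_mk]

theorem volume_euclidBasis : volume.real (ZSpan.fundamentalDomain D.euclidBasis) = 2401 / 8 := by
  rw [ZSpan.measureReal_fundamentalDomain _ _ (EuclideanSpace.basisFun (Fin 3 × Fin 4) ℝ).toBasis,
    coe_euclidBasis, Basis.det_apply, toMatrix_euclidMatrix, det_euclidMatrix,
    measureReal_congr (ZSpan.fundamentalDomain_ae_parallelepiped _ _), Measure.real,
    OrthonormalBasis.coe_toBasis, OrthonormalBasis.volume_parallelepiped]
  norm_num

theorem exists_euclid_eq {v : EuclideanSpace ℝ (Fin 3 × Fin 4)}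
    (hv : v ∈ Submodule.span ℤ (Set.range D.euclidBasis)) :
    ∃ q ∈ hurwitzOrder K, D.euclid q = v := by
  rw [Submodule.mem_span_range_iff_exists_fun] at hv
  obtain ⟨c, rfl⟩ := hv
  let f (t : Fin 4) : 𝓞 K := ∑ s, c (s, t) * D.intη ^ (s : ℕ)
  refine ⟨_, hurwitzMk_mem (f 0) (f 1) (f 2) (f 3), ?_⟩
  have hf (k : Fin 3) (t : Fin 4) : D.emb k (f t) = ∑ s, c (s, t) * D.emb k D.η ^ (s : ℕ) := by
    simp [f]
  rw [coe_euclidBasis]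
  ext ⟨k, l⟩
  rw [Fintype.sum_prod_type_right]
  fin_cases l <;>
    simp [euclid, coords, euclidMatrix, Fin.sum_univ_four, hf, Fin.sum_univ_three, map_ofNat] <;>
    ring

/-- Differences of elements of `M` are separated by `√3`, so the packing bound applies to the
lattice of `H`. It allows about 138 classes; 169 is the square convenient later. -/
theorem card_lt_of_incongruent {M : AddSubgroup ℍ[K]} (h1 : (hurwitzOrder K).toAddSubgroup ≤ M)
    (hmin : ∀ m ∈ M, m ≠ 0 → 1 ≤ D.absNorm m) (s : Finset ℍ[K]) (hs : ∀ m ∈ s, m ∈ M)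
    (hne : ∀ m ∈ s, ∀ n ∈ s, m - n ∈ hurwitzOrder K → m = n) : s.card < 169 := by
  classical
  have hsep (m) (hm : m ∈ s) (n) (hn : n ∈ s) (q) (hq : q ∈ hurwitzOrder K)
      (h : m ≠ n ∨ q ≠ 0) : 3 ≤ ‖D.euclid (m - n + q)‖ ^ 2 := by
    rw [norm_euclid_sq]
    refine D.three_le_sum_of_one_le_absNorm (hmin _ ?_ ?_)
    · exact add_mem (sub_mem (hs m hm) (hs n hn)) (h1 hq)
    · intro h0
      have h2 : m = n := hne m hm n hn (by rw [eq_neg_of_add_eq_zero_left h0]; exact neg_mem hq)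
      rw [h2, sub_self, zero_add] at h0
      tauto
  have hinj : Set.InjOn D.euclid s := by
    intro m hm n hn h
    by_contra hc
    have := hsep m hm n hn 0 (zero_mem _) (.inl hc)
    rw [add_zero, map_sub, h, sub_self] at this
    norm_num at this
  have key := card_mul_le_of_separated D.euclidBasis (by simp) (s.image D.euclid) (by
    intro x hx y hy l hl h
    obtain ⟨m, hm, rfl⟩ := Finset.mem_image.1 hx
    obtain ⟨n, hn, rfl⟩ := Finset.mem_image.1 hy
    obtain ⟨q, hq, rfl⟩ := D.exists_euclid_eq hl
    rw [← map_sub, ← map_add]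
    refine hsep m hm n hn q hq ?_
    rcases h with h | h
    · exact .inl fun h' => h (by rw [h'])
    · exact .inr fun h' => h (by rw [h', map_zero]))
  rw [Finset.card_image_of_injOn hinj, volume_euclidBasis] at key
  by_contra! hc
  have hc' : (169 : ℝ) ≤ s.card := by exact_mod_cast hc
  have hpi : (3.14 : ℝ) ^ 6 ≤ Real.pi ^ 6 :=
    pow_le_pow_left₀ (by norm_num) Real.pi_gt_d2.le 6
  have h3 : (169 : ℝ) * ((3.14 : ℝ) ^ 6 / 720 * ((3 / 2) ^ 7 / 7)) ≤ 3 / 2 * (2401 / 8) :=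
    le_trans (by gcongr) key
  norm_num at h3

end HeptagonalField

/-! ### Reduced modules and primes with large residue fields -/

namespace HeptagonalField
variable {K : Type*} [Field K] [NumberField K] (D : HeptagonalField K)

/-- A left module over the Hurwitz order, containing it, without nonzero elements of
absolute norm less than one. -/
structure IsReduced (M : AddSubgroup ℍ[K]) : Prop where
  mem_of_mem : ∀ h ∈ hurwitzOrder K, h ∈ M
  mul_left_mem : ∀ h ∈ hurwitzOrder K, ∀ m ∈ M, h * m ∈ M
  one_le : ∀ m ∈ M, m ≠ 0 → 1 ≤ D.absNorm m

variable {D} {M : AddSubgroup ℍ[K]}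

theorem IsReduced.smul_mem (hM : D.IsReduced M) (x : 𝓞 K) {m : ℍ[K]} (hm : m ∈ M) :
    (x : K) • m ∈ M := by
  rw [← Quaternion.coe_mul_eq_smul]
  exact hM.mul_left_mem _ (coe_mem_hurwitzOrder x) _ hm

theorem mem_of_smul_mem {m : ℍ[K]} {t z : 𝓞 K}
    (hz : ((z : K) * t - 1) • m ∈ hurwitzOrder K) (ht : (t : K) • m ∈ hurwitzOrder K) :
    m ∈ hurwitzOrder K := by
  have : m = (z : K) • (t : K) • m - ((z : K) * t - 1) • m := by
    rw [smul_smul, ← sub_smul]; simp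
  rw [this]
  exact sub_mem (smul_mem_hurwitzOrder _ ht) hz

/-- If `t` divides an integer prime to `n`, Bézout inverts `t` modulo `n`, hence on the class of `m`
modulo `H`. -/
theorem exists_inverse_of_isCoprime {m : ℍ[K]} {n N : ℤ} (hn : (n : K) • m ∈ hurwitzOrder K)
    (h : IsCoprime N n) {t y : 𝓞 K} (hty : t * y = (N : 𝓞 K)) :
    ∃ z : 𝓞 K, ((z : K) * t - 1) • m ∈ hurwitzOrder K := by
  obtain ⟨u, v, huv⟩ := h
  refine ⟨u * y, ?_⟩
  have h1 : ((u * y : 𝓞 K) : K) * t - 1 = ((-v : 𝓞 K) : K) * n := by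
    have h2 : (u * y * t - 1 : 𝓞 K) = -v * n := by
      have h3 : (u * N + v * n : 𝓞 K) = 1 := by exact_mod_cast congrArg (Int.cast : ℤ → 𝓞 K) huv
      linear_combination (u : 𝓞 K) * hty + h3
    simpa using congrArg (algebraMap (𝓞 K) K) h2
  rw [h1, mul_smul]
  exact smul_mem_hurwitzOrder _ hn

/-- Otherwise the classes of `m` and `g m` would be independent over the scalars `f`, giving at
least 13² incongruent elements of `M`. -/
theorem IsReduced.exists_mul_sub_smul_mem (hM : D.IsReduced M) {m : ℍ[K]} (hm : m ∈ M)
    (hm' : m ∉ hurwitzOrder K) {ι : Type*} [Fintype ι] (hι : 13 ≤ Fintype.card ι) (f : ι → 𝓞 K)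
    (hf : ∀ i j, i ≠ j → ∃ z : 𝓞 K, ((z : K) * (f i - f j : 𝓞 K) - 1) • m ∈ hurwitzOrder K)
    {g : ℍ[K]} (hg : g ∈ hurwitzOrder K) :
    ∃ z : 𝓞 K, g * m - (z : K) • m ∈ hurwitzOrder K := by
  classical
  by_contra! hc
  let F : ι × ι → ℍ[K] := fun p => (f p.1 : K) • m + (f p.2 : K) • (g * m)
  have key (p q : ι × ι) (h : F p - F q ∈ hurwitzOrder K) : p = q := by
    have h1 : F p - F q =
        ((f p.1 - f q.1 : 𝓞 K) : K) • m + ((f p.2 - f q.2 : 𝓞 K) : K) • (g * m) := by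
      simp only [F, map_sub]; module
    rw [h1] at h
    by_cases h2 : p.2 = q.2
    · simp only [h2, sub_self, map_zero, zero_smul, add_zero] at h
      by_contra h3
      obtain ⟨z, hz⟩ := hf p.1 q.1 fun h4 => h3 (Prod.ext h4 h2)
      exact hm' (mem_of_smul_mem hz h)
    · obtain ⟨z, hz⟩ := hf p.2 q.2 h2
      -- Inverting the coefficient of `g m` in the congruence solves for `g m` as a multiple of `m`.
      refine absurd ?_ (hc (-z * (f p.1 - f q.1)))
      have h3 := sub_mem (smul_mem_hurwitzOrder z h) (mul_mem hg hz)
      rw [mul_smul_comm] at h3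
      convert h3 using 1
      simp only [map_mul, map_neg]
      module
  have hinj : Function.Injective F := fun p q h => key p q (by rw [h, sub_self]; exact zero_mem _)
  have h1 := D.card_lt_of_incongruent hM.mem_of_mem hM.one_le (Finset.univ.image F) (by
    simp only [Finset.mem_image, Finset.mem_univ, true_and]
    rintro _ ⟨p, rfl⟩
    exact add_mem (hM.smul_mem _ hm) (hM.smul_mem _ (hM.mul_left_mem _ hg _ hm))) (by
    simp only [Finset.mem_image, Finset.mem_univ, true_and]
    rintro _ ⟨p, rfl⟩ _ ⟨q, rfl⟩ h
    rw [key p q h])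
  rw [Finset.card_image_of_injective _ hinj, Finset.card_univ, Fintype.card_prod] at h1
  nlinarith

theorem exists_ijk : ∃ i ∈ hurwitzOrder K, ∃ j ∈ hurwitzOrder K, ∃ k ∈ hurwitzOrder K,
    ∀ m : ℍ[K], (2 : K) • m = -(k * (i * (j * m) - j * (i * m))) := by
  have hi := quat_mem_hurwitzOrder (K := K) 0 1 0 0
  have hj := quat_mem_hurwitzOrder (K := K) 0 0 1 0
  have hk := quat_mem_hurwitzOrder (K := K) 0 0 0 1
  refine ⟨_, hi, _, hj, _, hk, fun m => ?_⟩
  ext <;> simp <;> ring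

/-- If `m ∉ H`, then `i` and `j` act on the class of `m` as scalars, so `ij - ji = 2k` kills it.
Since `k` and 2 act invertibly, `m ∈ H`. -/
theorem IsReduced.mem_of_separating (hM : D.IsReduced M) {m : ℍ[K]} (hm : m ∈ M)
    {ι : Type*} [Fintype ι] (hι : 13 ≤ Fintype.card ι) (f : ι → 𝓞 K)
    (hf : ∀ i j, i ≠ j → ∃ z : 𝓞 K, ((z : K) * (f i - f j : 𝓞 K) - 1) • m ∈ hurwitzOrder K)
    (h2 : ∃ z : 𝓞 K, ((z : K) * (2 : 𝓞 K) - 1) • m ∈ hurwitzOrder K) :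
    m ∈ hurwitzOrder K := by
  by_contra hm'
  obtain ⟨i, hi, j, hj, k, hk, hijk⟩ := exists_ijk (K := K)
  obtain ⟨z, hz⟩ := hM.exists_mul_sub_smul_mem hm hm' hι f hf hi
  obtain ⟨w, hw⟩ := hM.exists_mul_sub_smul_mem hm hm' hι f hf hj
  obtain ⟨t, ht⟩ := h2
  refine hm' (mem_of_smul_mem ht ?_)
  have h3 := sub_mem (add_mem (mul_mem hi hw) (smul_mem_hurwitzOrder w hz))
    (add_mem (mul_mem hj hz) (smul_mem_hurwitzOrder z hw))
  have h4 := neg_mem (mul_mem hk h3)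
  have h2 : ((2 : 𝓞 K) : K) = 2 := map_ofNat (algebraMap (𝓞 K) K) 2
  rw [h2, hijk]
  convert h4 using 3
  simp only [mul_sub, smul_sub, mul_smul_comm]
  rw [smul_comm (w : K) (z : K) m]
  abel

theorem IsReduced.mem_of_prime_ge (hM : D.IsReduced M) {m : ℍ[K]} (hm : m ∈ M) {p : ℕ}
    (hp : p.Prime) (h13 : 13 ≤ p) (h : (p : K) • m ∈ hurwitzOrder K) : m ∈ hurwitzOrder K := by
  have h' : ((p : ℤ) : K) • m ∈ hurwitzOrder K := by simpa using h
  have cop {N : ℤ} (h0 : N ≠ 0) (h1 : N.natAbs < p) : IsCoprime N p := by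
    rw [Int.isCoprime_iff_gcd_eq_one, Int.gcd, Int.natAbs_natCast]
    exact (Nat.coprime_of_lt_prime (by omega) h1 hp).symm
  refine hM.mem_of_separating hm (ι := Fin 13) (by simp) (fun i => ((i : ℕ) : 𝓞 K)) ?_ ?_
  · intro i j hij
    refine exists_inverse_of_isCoprime h' (N := (i : ℤ) - (j : ℤ)) (cop ?_ ?_) (y := 1) ?_
    · have : (i : ℕ) ≠ j := fun h => hij (Fin.ext h)
      omega
    · omega
    · push_cast; ring
  · exact exists_inverse_of_isCoprime h' (N := 2) (cop (by norm_num) (by omega)) (y := 1) (by simp)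

/-- Here `165 = 3 · 5 · 11`, and these primes are inert. The box contains all differences of
elements with coordinates in `{0, 1, 2}`, which supply 27 separating scalars. -/
theorem coprime_cubicNorm : ∀ a ∈ Finset.Icc (-2 : ℤ) 2, ∀ b ∈ Finset.Icc (-2 : ℤ) 2,
    ∀ c ∈ Finset.Icc (-2 : ℤ) 2, (a ≠ 0 ∨ b ≠ 0 ∨ c ≠ 0) →
      Int.gcd (cubicNorm a b c) 165 = 1 := by
  unfold cubicNorm
  decide +kernel

theorem IsReduced.mem_of_dvd (hM : D.IsReduced M) {m : ℍ[K]} (hm : m ∈ M) {p : ℕ}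
    (hp : p ∣ 165) (h : (p : K) • m ∈ hurwitzOrder K) : m ∈ hurwitzOrder K := by
  have h' : ((p : ℤ) : K) • m ∈ hurwitzOrder K := by simpa using h
  have hp' : (p : ℤ) ∣ 165 := by exact_mod_cast hp
  refine hM.mem_of_separating hm (ι := Fin 3 × Fin 3 × Fin 3) (by simp)
    (fun i => ((i.1 : ℕ) : ℤ) + ((i.2.1 : ℕ) : ℤ) * D.intη + ((i.2.2 : ℕ) : ℤ) * D.intη ^ 2) ?_ ?_
  · rintro ⟨a, b, c⟩ ⟨a', b', c'⟩ hne
    obtain ⟨y, hy⟩ := D.exists_mul_eq_cubicNorm ((a : ℕ) - (a' : ℕ)) ((b : ℕ) - (b' : ℕ)) ((c : ℕ) - (c' : ℕ))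
    refine exists_inverse_of_isCoprime h' (N := cubicNorm ((a : ℕ) - (a' : ℕ) : ℤ)
      ((b : ℕ) - (b' : ℕ)) ((c : ℕ) - (c' : ℕ))) ?_ (y := y) ?_
    · refine IsCoprime.of_isCoprime_of_dvd_right ?_ hp'
      rw [Int.isCoprime_iff_gcd_eq_one]
      refine coprime_cubicNorm _ ?_ _ ?_ _ ?_ ?_
      · rw [Finset.mem_Icc]; omega
      · rw [Finset.mem_Icc]; omega
      · rw [Finset.mem_Icc]; omega
      · by_contra! hc
        exact hne (Prod.ext (Fin.ext (by simp; omega))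
          (Prod.ext (Fin.ext (by simp; omega)) (Fin.ext (by simp; omega))))
    · rw [← hy]
      push_cast
      ring
  · refine exists_inverse_of_isCoprime h' (N := 2) ?_ (y := 1) (by simp)
    refine IsCoprime.of_isCoprime_of_dvd_right ?_ hp'
    norm_num

end HeptagonalField

/-! ### The ramified prime 7 -/

namespace HeptagonalField

theorem eq_zero_of_sq_add_sq_zmod_seven : ∀ a b : ZMod 7, a ^ 2 + b ^ 2 = 0 → a = 0 ∧ b = 0 := by
  decide +kernel

/-- For `f = ±1`, the product `(1 + fi)(x + yi)` has norm `-2 = 5`, which is a sum of two squares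
mod 7 only as `1 + 4`. Changing the sign of `f` swaps the two squares. -/
theorem exists_sign_of_sq_add_sq_zmod_seven : ∀ x y : ZMod 7, x ^ 2 + y ^ 2 = -1 →
    ∃ f : ZMod 7, f ^ 2 = 1 ∧ (x - f * y) ^ 2 = 1 ∧ (y + f * x) ^ 2 = 4 := by
  decide +kernel

/-- Left multiplication by `e + fi` scales the pair `(a + bi, c + di)` over `𝔽₄₉`. This brings any
nonzero isotropic quaternion mod 7 to the form `1 ± i ± j ± 2k`. -/
theorem exists_signs_zmod_seven (a b c d : ZMod 7) (h : a ^ 2 + b ^ 2 + c ^ 2 + d ^ 2 = 0)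
    (h0 : ¬(a = 0 ∧ b = 0 ∧ c = 0 ∧ d = 0)) :
    ∃ e f : ZMod 7, e * a - f * b = 1 ∧ (e * b + f * a) ^ 2 = 1 ∧
      (e * c - f * d) ^ 2 = 1 ∧ (e * d + f * c) ^ 2 = 4 := by
  have : Fact (Nat.Prime 7) := ⟨by norm_num⟩
  have hn : a ^ 2 + b ^ 2 ≠ 0 := by
    intro hn
    obtain ⟨ha, hb⟩ := eq_zero_of_sq_add_sq_zmod_seven a b hn
    obtain ⟨hc, hd⟩ := eq_zero_of_sq_add_sq_zmod_seven c d (by linear_combination h - hn)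
    exact h0 ⟨ha, hb, hc, hd⟩
  obtain ⟨n, hn'⟩ : ∃ n : ZMod 7, n * (a ^ 2 + b ^ 2) = 1 := ⟨_, inv_mul_cancel₀ hn⟩
  obtain ⟨f, h1, h2, h3⟩ := exists_sign_of_sq_add_sq_zmod_seven (n * (a * c + b * d))
    (n * (a * d - b * c)) (by
      linear_combination n ^ 2 * (a ^ 2 + b ^ 2) * h - (n * (a ^ 2 + b ^ 2) + 1) * hn')
  -- This is `(1 + fi)(a + bi)⁻¹`, with `n` the inverse of `a² + b²`.
  refine ⟨n * (a + f * b), n * (f * a - b), ?_, ?_, ?_, ?_⟩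
  · linear_combination hn'
  · rw [← h1]
    linear_combination f ^ 2 * (n * (a ^ 2 + b ^ 2) + 1) * hn'
  · rw [← h2]
    ring
  · rw [← h3]
    ring

theorem exists_signs (a b c d : ℤ) (h : 7 ∣ a ^ 2 + b ^ 2 + c ^ 2 + d ^ 2)
    (h0 : ¬(7 ∣ a ∧ 7 ∣ b ∧ 7 ∣ c ∧ 7 ∣ d)) :
    ∃ e f s t u : ℤ, s ^ 2 = 1 ∧ t ^ 2 = 1 ∧ u ^ 2 = 1 ∧ 7 ∣ e * a - f * b - 1 ∧
      7 ∣ e * b + f * a - s ∧ 7 ∣ e * c - f * d - t ∧ 7 ∣ e * d + f * c - 2 * u := by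
  have key (n : ℤ) : 7 ∣ n ↔ (n : ZMod 7) = 0 := (ZMod.intCast_zmod_eq_zero_iff_dvd n 7).symm
  simp only [key] at h h0 ⊢
  push_cast at h h0 ⊢
  obtain ⟨e, f, h1, h2, h3, h4⟩ := exists_signs_zmod_seven a b c d h h0
  have one : ∀ x : ZMod 7, x ^ 2 = 1 → x = 1 ∨ x = -1 := by decide +kernel
  have two : ∀ x : ZMod 7, x ^ 2 = 4 → x = 2 ∨ x = -2 := by decide +kernel
  have one' (x : ZMod 7) (hx : x ^ 2 = 1) : ∃ s : ℤ, s ^ 2 = 1 ∧ x - s = 0 := by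
    rcases one x hx with h | h
    · exact ⟨1, by norm_num, by simp [h]⟩
    · exact ⟨-1, by norm_num, by simp [h]⟩
  have two' (x : ZMod 7) (hx : x ^ 2 = 4) : ∃ s : ℤ, s ^ 2 = 1 ∧ x - 2 * s = 0 := by
    rcases two x hx with h | h
    · exact ⟨1, by norm_num, by simp [h]⟩
    · exact ⟨-1, by norm_num, by simp [h]⟩
  obtain ⟨e, rfl⟩ := ZMod.intCast_surjective e
  obtain ⟨f, rfl⟩ := ZMod.intCast_surjective f
  obtain ⟨s, hs, hs'⟩ := one' _ h2
  obtain ⟨t, ht, ht'⟩ := one' _ h3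
  obtain ⟨u, hu, hu'⟩ := two' _ h4
  exact ⟨e, f, s, t, u, hs, ht, hu, by rw [h1, sub_self], hs', ht', hu'⟩

variable {K : Type*} [Field K] [NumberField K] {D : HeptagonalField K} {M : AddSubgroup ℍ[K]}

theorem absNorm_coe (x : K) : D.absNorm (x : ℍ[K]) = (∏ k, D.emb k x) ^ 2 := by
  simp [absNorm, Quaternion.normSq_coe, Finset.prod_pow]

theorem absNorm_smul (x : K) (q : ℍ[K]) :
    D.absNorm (x • q) = (∏ k, D.emb k x) ^ 2 * D.absNorm q := by
  rw [← Quaternion.coe_mul_eq_smul, absNorm_mul, absNorm_coe]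

theorem seven_eq : (7 : 𝓞 K) = -(D.intη - 2) * ((D.intη - 2) ^ 2 + 7 * (D.intη - 2) + 14) := by
  linear_combination D.intη_root

theorem norm_π : ∏ k, D.emb k (D.η - 2) = -7 := by
  have := D.prod_emb_int (-2) 1 0
  norm_num [cubicNorm] at this
  rw [← this]
  simp only [map_sub, map_ofNat]
  refine Finset.prod_congr rfl fun k _ => ?_
  ring

theorem exists_eq_int_add (x : 𝓞 K) : ∃ (n : ℤ) (t : 𝓞 K), x = n + (D.intη - 2) * t := by
  obtain ⟨a, b, c, rfl⟩ := D.exists_int x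
  exact ⟨a + 2 * b + 4 * c, b + c * (D.intη + 2), by push_cast; ring⟩

theorem quat_int_mem (a b c d : ℤ) : quat (a : K) b c d ∈ hurwitzOrder K := by
  simpa using quat_mem_hurwitzOrder (a : 𝓞 K) b c d

theorem π_ne_zero : D.η - 2 ≠ 0 := by
  intro h
  have := norm_π (D := D)
  simp [h] at this

/-- The quaternion `(a + bi + cj + dk) / π`, where `π = η - 2` is the prime above seven. -/
noncomputable def quatDiv (D : HeptagonalField K) (a b c d : ℤ) : ℍ[K] := (D.η - 2)⁻¹ • quat (a : K) b c d

theorem quatDiv_mem_of_dvd {a b c d : ℤ} (ha : 7 ∣ a) (hb : 7 ∣ b) (hc : 7 ∣ c) (hd : 7 ∣ d) :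
    quatDiv D a b c d ∈ hurwitzOrder K := by
  obtain ⟨a, rfl⟩ := ha
  obtain ⟨b, rfl⟩ := hb
  obtain ⟨c, rfl⟩ := hc
  obtain ⟨d, rfl⟩ := hd
  have h : (D.η - 2)⁻¹ * 7 = ((-((D.intη - 2) ^ 2 + 7 * (D.intη - 2) + 14) : 𝓞 K) : K) := by
    rw [inv_mul_eq_iff_eq_mul₀ π_ne_zero]
    have := congrArg (algebraMap (𝓞 K) K) (seven_eq (D := D))
    simp only [map_neg, map_mul, map_add, map_sub, map_pow, map_ofNat, coe_intη] at this ⊢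
    linear_combination this
  have h2 := smul_mem_hurwitzOrder (-((D.intη - 2) ^ 2 + 7 * (D.intη - 2) + 14))
    (quat_int_mem (K := K) a b c d)
  rw [← h] at h2
  convert h2 using 1
  rw [quatDiv, mul_smul, smul_quat 7]
  push_cast
  rfl

theorem quatDiv_sub (a b c d a' b' c' d' : ℤ) : quatDiv D a b c d - quatDiv D a' b' c' d' =
    quatDiv D (a - a') (b - b') (c - c') (d - d') := by
  simp only [quatDiv, ← smul_sub, quat_sub]
  push_cast
  rfl

theorem IsReduced.quatDiv_mem_of_congr (hM : D.IsReduced M) {a b c d a' b' c' d' : ℤ}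
    (h : quatDiv D a b c d ∈ M) (ha : 7 ∣ a - a') (hb : 7 ∣ b - b') (hc : 7 ∣ c - c')
    (hd : 7 ∣ d - d') : quatDiv D a' b' c' d' ∈ M := by
  have := sub_mem h (hM.mem_of_mem _ (quatDiv_mem_of_dvd (D := D) ha hb hc hd))
  rw [quatDiv_sub] at this
  simpa using this

theorem IsReduced.mul_quatDiv_mem (hM : D.IsReduced M) (a' b' c' d' : ℤ) {a b c d : ℤ}
    (h : quatDiv D a b c d ∈ M) : quatDiv D (a' * a - b' * b - c' * c - d' * d)
      (a' * b + b' * a + c' * d - d' * c) (a' * c - b' * d + c' * a + d' * b)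
      (a' * d + b' * c - c' * b + d' * a) ∈ M := by
  have := hM.mul_left_mem _ (quat_int_mem a' b' c' d') _ h
  rw [quatDiv, mul_smul_comm, quat_mul] at this
  rw [quatDiv]
  push_cast
  exact this

theorem absNorm_quatDiv (q : ℍ[K]) : 49 * D.absNorm ((D.η - 2)⁻¹ • q) = D.absNorm q := by
  have h : q = (D.η - 2) • (D.η - 2)⁻¹ • q := by rw [smul_inv_smul₀ π_ne_zero]
  conv_rhs => rw [h, absNorm_smul, norm_π]
  norm_num

theorem half_quat_mem {s t u : ℤ} (hs : s ^ 2 = 1) (ht : t ^ 2 = 1) (hu : u ^ 2 = 1) :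
    quat (1 / 2 : K) (s / 2) (t / 2) (u / 2) ∈ hurwitzOrder K := by
  have odd {s : ℤ} (hs : s ^ 2 = 1) : ∃ r, s = 2 * r + 1 := by
    rcases (by simpa using hs : s = 1 ∨ s = -1) with rfl | rfl
    · exact ⟨0, rfl⟩
    · exact ⟨-1, rfl⟩
  obtain ⟨s, rfl⟩ := odd hs
  obtain ⟨t, rfl⟩ := odd ht
  obtain ⟨u, rfl⟩ := odd hu
  refine ⟨-s, s + u + 1, t - u, u - s, ?_⟩
  ext <;> simp <;> ring

/-- An isotropic numerator can be normalised to `1 + si + tj + 2uk`; adding the unit `(1 + si + tj +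
uk)/2` then gives an element of absolute norm `7/49`. An anisotropic one is invertible mod 7 and
gives `1/π`, of absolute norm `1/49`. -/
theorem IsReduced.dvd_of_quatDiv_mem (hM : D.IsReduced M) {a b c d : ℤ}
    (h : quatDiv D a b c d ∈ M) : 7 ∣ a ∧ 7 ∣ b ∧ 7 ∣ c ∧ 7 ∣ d := by
  by_contra h0
  by_cases hN : 7 ∣ a ^ 2 + b ^ 2 + c ^ 2 + d ^ 2
  · obtain ⟨e, f, s, t, u, hs, ht, hu, h1, h2, h3, h4⟩ := exists_signs a b c d hN h0
    have h5 := hM.quatDiv_mem_of_congr (hM.mul_quatDiv_mem e f 0 0 h) (a' := 1) (b' := s) (c' := t)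
      (d' := 2 * u) (by simpa using h1) (by simpa using h2) (by simpa using h3) (by simpa using h4)
    have h6 : quat (1 / 2 : K) (s / 2) (t / 2) (u / 2) ∈ M :=
      hM.mem_of_mem _ (half_quat_mem hs ht hu)
    have h7 := add_mem h5 h6
    -- With `π = η - 2`: `1/π + 1/2 = η/(2π)` and `2/π + 1/2 = (2 + η)/(2π)`. The numerator has
    -- reduced norm `1 + η + η²`, of norm 7.
    have h8 : quatDiv D 1 s t (2 * u) + quat (1 / 2 : K) (s / 2) (t / 2) (u / 2) =
        (D.η - 2)⁻¹ • quat (D.η / 2) (s * D.η / 2) (t * D.η / 2) (u * (2 + D.η) / 2) := by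
      have := π_ne_zero (D := D)
      rw [quatDiv, smul_quat, smul_quat, quat_add]
      push_cast
      congr 1 <;> field_simp <;> ring
    rw [h8] at h7
    have h9 := absNorm_quatDiv (D := D) (quat (D.η / 2) (s * D.η / 2) (t * D.η / 2) (u * (2 + D.η) / 2))
    have h10 : D.absNorm (quat (D.η / 2) (s * D.η / 2) (t * D.η / 2) (u * (2 + D.η) / 2)) = 7 := by
      have hs' : (s : K) ^ 2 = 1 := by exact_mod_cast hs
      have ht' : (t : K) ^ 2 = 1 := by exact_mod_cast ht
      have hu' : (u : K) ^ 2 = 1 := by exact_mod_cast hu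
      have : Quaternion.normSq (quat (D.η / 2) (s * D.η / 2) (t * D.η / 2) (u * (2 + D.η) / 2)) =
          (1 : ℤ) + (1 : ℤ) * D.η + (1 : ℤ) * D.η ^ 2 := by
        rw [normSq_quat]
        push_cast
        linear_combination D.η ^ 2 / 4 * hs' + D.η ^ 2 / 4 * ht' + (2 + D.η) ^ 2 / 4 * hu'
      rw [absNorm, this, prod_emb_int]
      norm_num [cubicNorm]
    have h11 := hM.one_le _ h7 (by
      intro h
      rw [h] at h9
      rw [h10] at h9
      simp [absNorm] at h9)
    linarith
  · have : IsCoprime (a ^ 2 + b ^ 2 + c ^ 2 + d ^ 2) 7 := by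
      rw [isCoprime_comm, Prime.coprime_iff_not_dvd (by norm_num)]
      exact hN
    obtain ⟨t, r, htr⟩ := this
    -- The multiplier is the conjugate times the inverse `t` of the norm mod 7.
    have h5 := hM.quatDiv_mem_of_congr (hM.mul_quatDiv_mem (t * a) (-(t * b)) (-(t * c)) (-(t * d)) h)
      (a' := 1) (b' := 0) (c' := 0) (d' := 0) ⟨-r, by linear_combination htr⟩ ⟨0, by ring⟩
      ⟨0, by ring⟩ ⟨0, by ring⟩
    have h6 := absNorm_quatDiv (D := D) (quat ((1 : ℤ) : K) (0 : ℤ) (0 : ℤ) (0 : ℤ))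
    have h7 : D.absNorm (quat ((1 : ℤ) : K) (0 : ℤ) (0 : ℤ) (0 : ℤ)) = 1 := by
      rw [absNorm, normSq_quat]
      simp
    rw [h7] at h6
    have h8 := hM.one_le _ h5 (by
      intro h
      rw [quatDiv] at h
      rw [h] at h6
      simp [absNorm] at h6)
    rw [quatDiv] at h8
    linarith

theorem IsReduced.mem_of_π_smul_mem (hM : D.IsReduced M) {m : ℍ[K]} (hm : m ∈ M)
    (h7 : (7 : K) • m ∈ hurwitzOrder K) (h : (D.η - 2) • m ∈ hurwitzOrder K) :
    m ∈ hurwitzOrder K := by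
  obtain ⟨x, y, z, w, hxyz⟩ := h
  obtain ⟨n₁, t₁, rfl⟩ := exists_eq_int_add (D := D) x
  obtain ⟨n₂, t₂, rfl⟩ := exists_eq_int_add (D := D) y
  obtain ⟨n₃, t₃, rfl⟩ := exists_eq_int_add (D := D) z
  obtain ⟨n₄, t₄, rfl⟩ := exists_eq_int_add (D := D) w
  have hπ := π_ne_zero (D := D)
  set h := hurwitzMk t₁ t₂ t₃ t₄
  have hh : h ∈ hurwitzOrder K := hurwitzMk_mem ..
  -- As `𝓞 K/π = 𝔽₇`, subtracting `h` leaves integer coordinates over `π`. The factor 8 clears the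
  -- halves, and `8 ≡ 1 mod 7` lets `m` be recovered from `7m ∈ H`.
  have h1 : (8 : K) • (m - h) = quatDiv D (8 * n₁ + 4 * n₂ - 4 * n₄) (4 * n₂ - 4 * n₄)
      (8 * n₃ + 4 * n₂ + 4 * n₄) (4 * n₂ + 4 * n₄) := by
    have h2 : m = (D.η - 2)⁻¹ • (D.η - 2) • m := (inv_smul_smul₀ hπ m).symm
    have h3 : h = (D.η - 2)⁻¹ • (D.η - 2) • h := (inv_smul_smul₀ hπ h).symm
    rw [h2, h3, hxyz, ← smul_sub, smul_comm, quatDiv]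
    congr 1
    ext <;> simp [h, map_ofNat] <;> ring
  have e8 : ((8 : 𝓞 K) : K) = 8 := map_ofNat (algebraMap (𝓞 K) K) 8
  have h2 : (8 : K) • (m - h) ∈ M := by
    rw [← e8]
    exact hM.smul_mem 8 (sub_mem hm (hM.mem_of_mem h hh))
  rw [h1] at h2
  obtain ⟨d1, d2, d3, d4⟩ := hM.dvd_of_quatDiv_mem h2
  have h3 := quatDiv_mem_of_dvd (D := D) d1 d2 d3 d4
  rw [← h1] at h3
  have h4 : m = (8 : K) • (m - h) - (7 : K) • m + (8 : K) • h := by module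
  rw [h4]
  refine add_mem (sub_mem h3 h7) ?_
  rw [← e8]
  exact smul_mem_hurwitzOrder 8 hh

theorem IsReduced.mem_of_seven_smul_mem (hM : D.IsReduced M) {m : ℍ[K]} (hm : m ∈ M)
    (h7 : (7 : K) • m ∈ hurwitzOrder K) : m ∈ hurwitzOrder K := by
  have e : ((D.intη - 2 : 𝓞 K) : K) = D.η - 2 := by simp [map_ofNat]
  have step (m : ℍ[K]) (hm : m ∈ M) (h7 : (7 : K) • m ∈ hurwitzOrder K) :
      (D.η - 2) • m ∈ M ∧ (7 : K) • (D.η - 2) • m ∈ hurwitzOrder K := by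
    rw [smul_comm (7 : K), ← e]
    exact ⟨hM.smul_mem _ hm, smul_mem_hurwitzOrder _ h7⟩
  obtain ⟨hm1, h71⟩ := step m hm h7
  obtain ⟨hm2, h72⟩ := step _ hm1 h71
  refine hM.mem_of_π_smul_mem hm h7 (hM.mem_of_π_smul_mem hm1 h71 (hM.mem_of_π_smul_mem hm2 h72 ?_))
  -- Here `π³ = -7(η - 1)²`, so three divisions by `π` suffice.
  have := smul_mem_hurwitzOrder (-((D.intη - 1) ^ 2)) h7
  convert this using 1
  simp only [smul_smul]
  congr 1
  simp only [map_neg, map_pow, map_sub, map_one, coe_intη]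
  linear_combination D.root

end HeptagonalField

/-! ### The inert prime 2 -/

namespace HeptagonalField
variable {K : Type*} [Field K] [NumberField K] {D : HeptagonalField K} {M : AddSubgroup ℍ[K]}

theorem even_of_two_dvd_cubicNorm {a b c : ℤ} (h : 2 ∣ cubicNorm a b c) :
    2 ∣ a ∧ 2 ∣ b ∧ 2 ∣ c := by
  have key (n : ℤ) : 2 ∣ n ↔ (n : ZMod 2) = 0 := (ZMod.intCast_zmod_eq_zero_iff_dvd n 2).symm
  have h2 : ∀ a b c : ZMod 2, cubicNorm a b c = 0 → a = 0 ∧ b = 0 ∧ c = 0 := by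
    unfold cubicNorm
    decide
  simp only [key] at h ⊢
  apply h2
  rw [← h]
  simp [cubicNorm]

include D in
theorem exists_inverse_mod_two (x : 𝓞 K) (hx : ¬2 ∣ x) : ∃ t s : 𝓞 K, t * x = 1 + 2 * s := by
  obtain ⟨a, b, c, rfl⟩ := D.exists_int x
  obtain ⟨y, hy⟩ := D.exists_mul_eq_cubicNorm a b c
  have hodd : ¬2 ∣ cubicNorm a b c := by
    intro h
    obtain ⟨⟨a, rfl⟩, ⟨b, rfl⟩, ⟨c, rfl⟩⟩ := even_of_two_dvd_cubicNorm h
    exact hx ⟨a + b * D.intη + c * D.intη ^ 2, by push_cast; ring⟩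
  obtain ⟨k, hk⟩ : ∃ k, cubicNorm a b c = 1 + 2 * k := ⟨(cubicNorm a b c - 1) / 2, by omega⟩
  rw [hk] at hy
  exact ⟨y, k, by rw [mul_comm, hy]; push_cast; rfl⟩

include D in
theorem even_of_two_dvd {a b c : ℤ} (h : 2 ∣ (a + b * D.intη + c * D.intη ^ 2)) :
    2 ∣ a ∧ 2 ∣ b ∧ 2 ∣ c := by
  obtain ⟨y, hy⟩ := h
  obtain ⟨a', b', c', rfl⟩ := D.exists_int y
  have h := D.repr_int a b c
  have h' := D.repr_int (2 * a') (2 * b') (2 * c')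
  have e : (a + b * D.intη + c * D.intη ^ 2) = ((2 * a' : ℤ) : 𝓞 K) + (2 * b' : ℤ) * D.intη + (2 * c' : ℤ) * D.intη ^ 2 := by
    rw [hy]; push_cast; ring
  rw [e, h'] at h
  have h := Finsupp.equivFunOnFinite.symm.injective h
  exact ⟨⟨a', (congrFun h 0).symm⟩, ⟨b', (congrFun h 1).symm⟩, ⟨c', (congrFun h 2).symm⟩⟩

include D in
theorem two_not_dvd_sq_add_self_add_one (t : 𝓞 K) : ¬2 ∣ t ^ 2 + t + 1 := by
  obtain ⟨a, b, c, rfl⟩ := D.exists_int t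
  intro h
  have e : (a + b * D.intη + c * D.intη ^ 2) ^ 2 + (a + b * D.intη + c * D.intη ^ 2) + 1 =
      ((a ^ 2 + 2 * b * c - c ^ 2 + a + 1 : ℤ) : 𝓞 K) +
      ((2 * a * b + 4 * b * c - c ^ 2 + b : ℤ) : 𝓞 K) * D.intη +
      ((b ^ 2 + 2 * a * c - 2 * b * c + 3 * c ^ 2 + c : ℤ) : 𝓞 K) * D.intη ^ 2 := by
    push_cast
    linear_combination (2 * b * c + c ^ 2 * D.intη - c ^ 2 : 𝓞 K) * D.intη_root
  rw [e] at h
  obtain ⟨h1, h2, h3⟩ := even_of_two_dvd h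
  have key (n : ℤ) : 2 ∣ n ↔ (n : ZMod 2) = 0 := (ZMod.intCast_zmod_eq_zero_iff_dvd n 2).symm
  simp only [key] at h1 h2 h3
  push_cast at h1 h2 h3
  generalize (a : ZMod 2) = a at *
  generalize (b : ZMod 2) = b at *
  generalize (c : ZMod 2) = c at *
  revert a b c
  decide

include D in
-- The form stays anisotropic over `𝓞 K/2 = 𝔽₈`, an extension of odd degree in which `t² + t + 1`
-- has no root.
theorem two_dvd_of_two_dvd_form {x y : 𝓞 K} (h : 2 ∣ x ^ 2 + x * y + y ^ 2) : 2 ∣ x ∧ 2 ∣ y := by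
  by_cases hy : 2 ∣ y
  · refine ⟨?_, hy⟩
    by_contra hx
    obtain ⟨t, s, hts⟩ := exists_inverse_mod_two (D := D) x hx
    obtain ⟨y, rfl⟩ := hy
    obtain ⟨n, hn⟩ := h
    obtain ⟨z, hz⟩ : (2 : 𝓞 K) ∣ 1 := ⟨t ^ 2 * (n - x * y - 2 * y ^ 2) - 2 * s - 2 * s ^ 2, by
      linear_combination (-t * x - 1 - 2 * s) * hts + t ^ 2 * hn⟩
    have := even_of_two_dvd (D := D) (a := 1) (b := 0) (c := 0) ⟨z, by simpa using hz⟩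
    norm_num at this
  · obtain ⟨t, s, hts⟩ := exists_inverse_mod_two (D := D) y hy
    obtain ⟨n, hn⟩ := h
    refine absurd ⟨t ^ 2 * n - 2 * s - 2 * s ^ 2 - t * x * s, ?_⟩
      (two_not_dvd_sq_add_self_add_one (D := D) (t * x))
    linear_combination (-t * y - 1 - 2 * s - t * x) * hts + t ^ 2 * hn

/-- The element `(1 - j) / 2`, an inverse of `1 + j`. -/
noncomputable def halfOneSubJ (K : Type*) [Field K] : ℍ[K] := quat (1 / 2) 0 (-1 / 2) 0

include D in
-- Modulo 2 the norm is `X² + XY + Y²` with `X = x + z`, `Y = y + w`; both must be even, which is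
-- right divisibility by `1 + j`.
theorem mul_halfOneSubJ_mem {q : ℍ[K]} (hq : q ∈ hurwitzOrder K) {n : 𝓞 K}
    (hn : Quaternion.normSq q = n) (h : 2 ∣ n) : q * halfOneSubJ K ∈ hurwitzOrder K := by
  obtain ⟨x, y, z, w, rfl⟩ := hq
  rw [normSq_hurwitzMk] at hn
  have hn' := NumberField.RingOfIntegers.ext hn
  obtain ⟨n, rfl⟩ := h
  obtain ⟨⟨X, hX⟩, ⟨Y, hY⟩⟩ := two_dvd_of_two_dvd_form (D := D) (x := x + z) (y := y + w)
    ⟨n + x * z + y * w + x * w, by linear_combination hn'⟩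
  obtain rfl : x = 2 * X - z := by linear_combination hX
  obtain rfl : y = 2 * Y - w := by linear_combination hY
  refine ⟨X, Y, z - X, w - Y, ?_⟩
  ext <;> simp [halfOneSubJ, map_ofNat] <;> ring

/-- Multiplying by `star h` and by an inverse of its norm mod 2 cancels `h` up to `2e`-multiples in
`H`. -/
theorem IsReduced.mem_of_mul_mem (hM : D.IsReduced M) {h e : ℍ[K]} (hh : h ∈ hurwitzOrder K)
    (he : (2 : K) • e ∈ hurwitzOrder K) {k : 𝓞 K} (hk : Quaternion.normSq h = k) (h2 : ¬2 ∣ k)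
    (hm : h * e ∈ M) : e ∈ M := by
  obtain ⟨t, s, hts⟩ := exists_inverse_mod_two (D := D) k h2
  have h1 := hM.smul_mem t (hM.mul_left_mem _ (star_mem_hurwitzOrder hh) _ hm)
  rw [← mul_assoc, Quaternion.star_mul_self, hk, Quaternion.coe_mul_eq_smul, smul_smul] at h1
  have h3 := sub_mem h1 (hM.mem_of_mem _ (smul_mem_hurwitzOrder s he))
  convert h3 using 1
  have h4 : (t : K) * k = 1 + 2 * s := by
    have := congrArg (algebraMap (𝓞 K) K) hts
    simpa only [map_mul, map_add, map_one, map_ofNat] using this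
  rw [h4, smul_smul, ← sub_smul]
  ring_nf
  rw [one_smul]

/-- Divide `2m` on the right by `1 + j`. Two divisions give `m ∈ H` since `(1 + j)² = 2j`; stopping
after one or none puts `(1 + j)/2` or `1/2` in `M`, of absolute norm `1/8` or `1/64`. -/
theorem IsReduced.mem_of_two_smul_mem (hM : D.IsReduced M) {m : ℍ[K]} (hm : m ∈ M)
    (h : (2 : K) • m ∈ hurwitzOrder K) : m ∈ hurwitzOrder K := by
  by_contra hm'
  have h1j := quat_int_mem (K := K) 1 0 1 0
  obtain ⟨n, hn⟩ := exists_normSq_eq h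
  by_cases h2 : 2 ∣ n
  · have h3 := mul_halfOneSubJ_mem (D := D) h hn h2
    obtain ⟨k, hk⟩ := exists_normSq_eq h3
    by_cases h4 : 2 ∣ k
    · have h5 := mul_halfOneSubJ_mem (D := D) h3 hk h4
      have h6 := mul_mem h5 (quat_int_mem (K := K) 0 0 1 0)
      apply hm'
      convert h6 using 1
      ext <;> simp [halfOneSubJ] <;> ring
    · have h5 := hM.mem_of_mul_mem (e := quat (1 / 2) 0 (1 / 2) 0) h3 (by
        convert h1j using 1
        rw [smul_quat]
        push_cast
        congr 1 <;> ring) hk h4 (by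
        convert hm using 1
        ext <;> simp [halfOneSubJ] <;> ring)
      have h6 : D.absNorm (quat (1 / 2) 0 (1 / 2) 0) = 1 / 8 := by
        rw [absNorm, normSq_quat, Fin.prod_univ_three]
        norm_num [map_ofNat]
      have h7 := hM.one_le _ h5 fun h0 => by
        rw [h0] at h6
        norm_num [absNorm] at h6
      rw [h6] at h7
      norm_num at h7
  · have h5 := hM.mem_of_mul_mem (e := quat (1 / 2) 0 0 0) h (by
      convert one_mem (hurwitzOrder K) using 1
      ext <;> simp) hn h2 (by
      convert hm using 1
      ext <;> simp <;> ring)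
    have h6 : D.absNorm (quat (1 / 2) 0 0 0) = 1 / 64 := by
      rw [absNorm, normSq_quat, Fin.prod_univ_three]
      norm_num [map_ofNat]
    have h7 := hM.one_le _ h5 fun h0 => by
      rw [h0] at h6
      norm_num [absNorm] at h6
    rw [h6] at h7
    norm_num at h7

theorem exists_pos_smul_mem_hurwitzOrder (q : ℍ[K]) :
    ∃ n : ℕ, 0 < n ∧ (n : K) • q ∈ hurwitzOrder K := by
  have key (x : K) : ∃ n : ℕ, 0 < n ∧ ∃ y : 𝓞 K, (y : K) = n * x := by
    have hx : IsAlgebraic ℤ x :=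
      (IsFractionRing.isAlgebraic_iff ℤ ℚ K).2 (Algebra.IsAlgebraic.isAlgebraic x)
    obtain ⟨n, hn, h⟩ := hx.exists_integral_multiple
    have h' : IsIntegral ℤ (n.natAbs * x) := by
      rcases Int.natAbs_eq n with e | e <;> rw [e] at h
      · simpa using h
      · simpa using h.neg
    exact ⟨n.natAbs, Int.natAbs_pos.2 hn, ⟨_, h'⟩, rfl⟩
  obtain ⟨a, ha, x, hx⟩ := key q.re
  obtain ⟨b, hb, y, hy⟩ := key q.imI
  obtain ⟨c, hc, z, hz⟩ := key q.imJ
  obtain ⟨d, hd, w, hw⟩ := key q.imK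
  refine ⟨a * b * c * d, by positivity, ?_⟩
  have h := quat_mem_hurwitzOrder (K := K) (b * c * d * x) (a * c * d * y) (a * b * d * z)
    (a * b * c * w)
  simp only [map_mul, map_natCast, hx, hy, hz, hw] at h
  convert h using 1
  ext <;> simp <;> ring

theorem IsReduced.mem_hurwitzOrder (hM : D.IsReduced M) {m : ℍ[K]} (hm : m ∈ M) :
    m ∈ hurwitzOrder K := by
  classical
  have hprime (p : ℕ) (hp : p.Prime) (m : ℍ[K]) (hm : m ∈ M)
      (h : (p : K) • m ∈ hurwitzOrder K) : m ∈ hurwitzOrder K := by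
    by_cases h13 : 13 ≤ p
    · exact hM.mem_of_prime_ge hm hp h13 h
    · push Not at h13
      by_cases h2 : p = 2
      · subst h2
        exact hM.mem_of_two_smul_mem hm h
      by_cases h7 : p = 7
      · subst h7
        exact hM.mem_of_seven_smul_mem hm h
      have h165 : p ∣ 165 := by
        interval_cases p <;> revert hp h2 h7 <;> decide
      exact hM.mem_of_dvd hm h165 h
  have hall (n : ℕ) : ∀ m ∈ M, 0 < n → (n : K) • m ∈ hurwitzOrder K → m ∈ hurwitzOrder K := by
    induction n using Nat.recOnMul with
    | zero => simp
    | one => intro m _ _ h; simpa using h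
    | prime p hp => exact fun m hm _ h => hprime p hp m hm h
    | mul a b iha ihb =>
      intro m hm hab h
      have ha : 0 < a := Nat.pos_of_mul_pos_right hab
      have hb : 0 < b := Nat.pos_of_mul_pos_left hab
      refine ihb m hm hb (iha _ (by simpa using hM.smul_mem b hm) ha ?_)
      rw [smul_smul]
      exact_mod_cast h
  obtain ⟨n, hn, h⟩ := exists_pos_smul_mem_hurwitzOrder m
  exact hall n m hm hn h

/-! ### Principal left ideals -/

theorem exists_nat_absNorm {q : ℍ[K]} (hq : q ∈ hurwitzOrder K) : ∃ n : ℕ, D.absNorm q = n := by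
  obtain ⟨x, hx⟩ := exists_normSq_eq hq
  obtain ⟨n, hn⟩ := D.exists_int_prod_emb x
  rw [← hx] at hn
  have h0 : (0 : ℝ) ≤ n := by
    rw [← hn]
    exact Finset.prod_nonneg fun k _ => D.emb_normSq_nonneg k q
  lift n to ℕ using by exact_mod_cast h0
  exact ⟨n, by simpa [absNorm] using hn⟩

include D in
theorem isPrincipalIdealRing_hurwitzOrder : IsPrincipalIdealRing (hurwitzOrder K) := by
  refine ⟨fun I => ?_⟩
  by_cases hI : I = ⊥
  · exact ⟨0, by simp [hI]⟩
  choose N hN using fun q : hurwitzOrder K => exists_nat_absNorm (D := D) q.2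
  obtain ⟨c, hcI, hc0⟩ := Submodule.exists_mem_ne_zero_of_ne_bot hI
  obtain ⟨b, hbI, hb0, hmin⟩ : ∃ b ∈ I, b ≠ 0 ∧ ∀ q ∈ I, q ≠ 0 → N b ≤ N q :=
    have hne : {q | q ∈ I ∧ q ≠ 0}.Nonempty := ⟨c, hcI, hc0⟩
    ⟨Function.argminOn N _ hne, (Function.argminOn_mem N _ hne).1,
      (Function.argminOn_mem N _ hne).2, fun q hq hq0 =>
      Function.argminOn_le N _ (show q ∈ {q | q ∈ I ∧ q ≠ 0} from ⟨hq, hq0⟩)⟩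
  have hb0' : (b : ℍ[K]) ≠ 0 := by simpa using hb0
  obtain ⟨b', hb'⟩ : ∃ b' : ℍ[K], b' * b = 1 := by
    refine ⟨(Quaternion.normSq (b : ℍ[K]))⁻¹ • star (b : ℍ[K]), ?_⟩
    have h0 : Quaternion.normSq (b : ℍ[K]) ≠ 0 := fun h => by
      simpa [h] using toReal_normSq_pos D.toReal hb0'
    rw [smul_mul_assoc, Quaternion.star_mul_self, Quaternion.smul_coe, inv_mul_cancel₀ h0,
      Quaternion.coe_one]
  -- This is `I b⁻¹`; minimality of `b` and multiplicativity of the norm make it reduced.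
  let M : AddSubgroup ℍ[K] :=
    (I.toAddSubgroup.map (hurwitzOrder K).subtype.toAddMonoidHom).comap (AddMonoidHom.mulRight b)
  have hmem (m : ℍ[K]) : m ∈ M ↔ ∃ x ∈ I, (x : ℍ[K]) = m * b := Iff.rfl
  have hM : D.IsReduced M := by
    refine ⟨fun h hh => ?_, fun h hh m hm => ?_, fun m hm hm0 => ?_⟩
    · exact (hmem _).2 ⟨⟨h, hh⟩ * b, I.mul_mem_left _ hbI, rfl⟩
    · obtain ⟨x, hx, hxm⟩ := (hmem _).1 hm
      exact (hmem _).2 ⟨⟨h, hh⟩ * x, I.mul_mem_left _ hx, by simp [hxm, mul_assoc]⟩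
    · obtain ⟨x, hx, hxm⟩ := (hmem _).1 hm
      have h1 := hmin x hx fun h => (D.absNorm_pos hm0).ne' (by
        have h2 : D.absNorm m * D.absNorm b = 0 := by
          rw [← absNorm_mul, ← hxm, h]
          simp [absNorm]
        exact (mul_eq_zero.1 h2).resolve_right (D.absNorm_pos hb0').ne')
      have h2 : (N b : ℝ) ≤ N x := by exact_mod_cast h1
      rw [← hN, ← hN, hxm, absNorm_mul] at h2
      exact le_of_mul_le_mul_right (by simpa using h2) (D.absNorm_pos hb0')
  refine ⟨b, le_antisymm (fun x hx => ?_) ((Submodule.span_singleton_le_iff_mem _ _).2 hbI)⟩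
  have hxb : (x : ℍ[K]) * b' * b = x := by rw [mul_assoc, hb', mul_one]
  exact Submodule.mem_span_singleton.2
    ⟨⟨_, hM.mem_hurwitzOrder ((hmem _).2 ⟨x, hx, hxb.symm⟩)⟩, Subtype.ext hxb⟩

end HeptagonalField

/-! ### Norms of Hurwitz quaternions -/

namespace HeptagonalField
variable {K : Type*} [Field K] [NumberField K] (D : HeptagonalField K)

theorem exists_dvd_sq_add_sq_add_one {p : 𝓞 K} (hp : Prime p) :
    ∃ a b : 𝓞 K, p ∣ a ^ 2 + b ^ 2 + 1 := by
  have hmax : (Ideal.span {p}).IsMaximal :=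
    ((Ideal.span_singleton_prime hp.ne_zero).2 hp).isMaximal
      (by simpa using hp.ne_zero)
  have hne : Ideal.span {p} ≠ ⊥ := by simpa using hp.ne_zero
  let := Ideal.Quotient.field (Ideal.span {p})
  have : Finite (𝓞 K ⧸ Ideal.span {p}) := Ideal.finiteQuotientOfFreeOfNeBot _ hne
  let := Fintype.ofFinite (𝓞 K ⧸ Ideal.span {p})
  obtain ⟨a, b, h⟩ : ∃ a b : 𝓞 K ⧸ Ideal.span {p}, a ^ 2 + b ^ 2 + 1 = 0 := by
    by_cases h2 : ringChar (𝓞 K ⧸ Ideal.span {p}) = 2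
    · have := ringChar.of_eq h2
      exact ⟨1, 0, by simpa [one_add_one_eq_two] using CharP.cast_eq_zero (𝓞 K ⧸ Ideal.span {p}) 2⟩
    · obtain ⟨a, b, h⟩ := FiniteField.exists_root_sum_quadratic
        (R := 𝓞 K ⧸ Ideal.span {p}) (f := .X ^ 2) (g := .X ^ 2 + 1)
        (by simp) (by compute_degree!)
        (FiniteField.odd_card_of_char_ne_two h2)
      exact ⟨a, b, by simpa [add_assoc] using h⟩
  obtain ⟨a, rfl⟩ := Ideal.Quotient.mk_surjective a
  obtain ⟨b, rfl⟩ := Ideal.Quotient.mk_surjective b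
  exact ⟨a, b, Ideal.mem_span_singleton.1 (Ideal.Quotient.eq_zero_iff_mem.1 (by simpa using h))⟩

theorem exists_normSq_add_smul (p : 𝓞 K) {q r : ℍ[K]} (hq : q ∈ hurwitzOrder K)
    (hr : r ∈ hurwitzOrder K) :
    ∃ t : 𝓞 K, Quaternion.normSq (q + (p : K) • r) = Quaternion.normSq q + p * t := by
  obtain ⟨x, y, z, w, rfl⟩ := hq
  obtain ⟨x', y', z', w', rfl⟩ := hr
  refine ⟨2 * x * x' + x * y' + x' * y + 2 * y * y' + y * z' + y' * z - x * w' - x' * w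
    + 2 * z * z' + z * w' + z' * w + 2 * w * w' + p * (x' ^ 2 + x' * y' + y' ^ 2 + y' * z'
    - x' * w' + z' ^ 2 + z' * w' + w' ^ 2), ?_⟩
  rw [smul_hurwitzMk, hurwitzMk_add, normSq_hurwitzMk, normSq_hurwitzMk, ← map_mul, ← map_add]
  congr 1
  ring

include D in
-- Let `d` generate the left ideal of `Q = a + bi + j` and `p`, and write `p = e d`. Both generators
-- have norm divisible by `p`, hence so does `d`, and `N(e) N(d) = p²`. If `N(e)` were a unit, `p`
-- would divide `Q`, contradicting its `j`-coordinate 1.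
theorem exists_normSq_associated_prime {p : 𝓞 K} (hp : Prime p) :
    ∃ q ∈ hurwitzOrder K, ∃ n : 𝓞 K, Quaternion.normSq q = n ∧ Associated n p := by
  obtain ⟨a, b, c, hc⟩ := exists_dvd_sq_add_sq_add_one hp
  have hq : quat (a : K) b 1 0 ∈ hurwitzOrder K := by
    simpa using quat_mem_hurwitzOrder a b 1 0
  have hqn : Quaternion.normSq (quat (a : K) b 1 0) = (p * c : 𝓞 K) := by
    rw [normSq_quat, ← hc]
    simp
  have hqp (r : ℍ[K]) (hr : r ∈ hurwitzOrder K) : quat (a : K) b 1 0 ≠ (p : K) • r := by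
    obtain ⟨x, y, z, w, rfl⟩ := hr
    rw [smul_hurwitzMk]
    intro h
    have hJ := congrArg QuaternionAlgebra.imJ h
    have hK := congrArg QuaternionAlgebra.imK h
    simp only [imJ_quat, imK_quat, imJ_hurwitzMk, imK_hurwitzMk] at hJ hK
    rw [← hK, add_zero, ← map_one (algebraMap (𝓞 K) K)] at hJ
    exact hp.not_isUnit (IsUnit.of_mul_eq_one z (NumberField.RingOfIntegers.ext hJ.symm))
  have := D.isPrincipalIdealRing_hurwitzOrder
  let P : hurwitzOrder K := ⟨_, coe_mem_hurwitzOrder p⟩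
  let Q : hurwitzOrder K := ⟨_, hq⟩
  obtain ⟨d, hd⟩ := (IsPrincipalIdealRing.principal (Ideal.span {Q, P})).principal
  obtain ⟨e, he⟩ : ∃ e, e * d = P := Submodule.mem_span_singleton.1
    (hd ▸ Ideal.subset_span (by simp))
  obtain ⟨e', he'⟩ : ∃ e, e * d = Q := Submodule.mem_span_singleton.1
    (hd ▸ Ideal.subset_span (by simp))
  obtain ⟨h, g, hhg⟩ : ∃ h g, h * Q + g * P = d := Ideal.mem_span_pair.1
    (hd ▸ Submodule.mem_span_singleton_self d)
  replace he : (e : ℍ[K]) * d = ((p : K) : ℍ[K]) := congrArg Subtype.val he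
  replace he' : (e' : ℍ[K]) * d = quat (a : K) b 1 0 := congrArg Subtype.val he'
  replace hhg : (h : ℍ[K]) * quat (a : K) b 1 0 + g * ((p : K) : ℍ[K]) = d :=
    congrArg Subtype.val hhg
  obtain ⟨n, hn⟩ := exists_normSq_eq d.2
  obtain ⟨m, hm⟩ := exists_normSq_eq e.2
  have hmn : m * n = p ^ 2 := by
    have h1 := congrArg Quaternion.normSq he
    rw [map_mul, hn, hm, Quaternion.normSq_coe] at h1
    exact NumberField.RingOfIntegers.ext (by simpa using h1)
  have hpn : p ∣ n := by
    obtain ⟨k, hk⟩ := exists_normSq_eq h.2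
    obtain ⟨t, ht⟩ := exists_normSq_add_smul p (mul_mem h.2 hq) g.2
    rw [← Quaternion.mul_coe_eq_smul, hhg, map_mul, hk, hqn, hn] at ht
    exact ⟨k * c + t, NumberField.RingOfIntegers.ext (by
      rw [ht]; simp only [map_mul, map_add]; ring)⟩
  refine ⟨d, d.2, n, hn, ?_⟩
  obtain ⟨t, rfl⟩ := hpn
  have hmt : m * t = p := mul_left_cancel₀ hp.ne_zero (by linear_combination hmn)
  rcases hp.irreducible.isUnit_or_isUnit hmt.symm with hu | hu
  · obtain ⟨u, hu⟩ := hu.exists_left_inv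
    refine absurd ?_ (hqp ((e' : ℍ[K]) * ((u : K) • star (e : ℍ[K])))
      (mul_mem e'.2 (smul_mem_hurwitzOrder u (star_mem_hurwitzOrder e.2))))
    have h1 : (u : K) • star (e : ℍ[K]) * e = 1 := by
      rw [smul_mul_assoc, Quaternion.star_mul_self, hm, Quaternion.smul_coe, ← map_mul, hu]
      simp
    rw [← he', ← Quaternion.mul_coe_eq_smul, ← he, mul_assoc, ← mul_assoc _ (e : ℍ[K]), h1, one_mul]
  · exact associated_mul_unit_left p t hu

include D in
theorem exists_normSq_associated (a : 𝓞 K) :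
    ∃ q ∈ hurwitzOrder K, ∃ n : 𝓞 K, Quaternion.normSq q = n ∧ Associated n a := by
  have := D.isPrincipalIdealRing_integers
  induction a using UniqueFactorizationMonoid.induction_on_prime with
  | h₁ => exact ⟨0, zero_mem _, 0, by simp, .refl _⟩
  | h₂ u hu => exact ⟨1, one_mem _, 1, by simp, associated_one_iff_isUnit.2 hu |>.symm⟩
  | h₃ a p _ hp ih =>
    obtain ⟨q, hq, n, hn, h⟩ := ih
    obtain ⟨r, hr, m, hm, h'⟩ := D.exists_normSq_associated_prime hp
    exact ⟨r * q, mul_mem hr hq, m * n, by simp only [map_mul, hn, hm], h'.mul_mul h⟩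

include D in
theorem exists_normSq_eq_of_totallyPositive {a : 𝓞 K} (ha : ∀ σ : K →+* ℝ, 0 < σ a) :
    ∃ q ∈ hurwitzOrder K, Quaternion.normSq q = a := by
  obtain ⟨q, hq, n, hn, u, rfl⟩ := D.exists_normSq_associated a
  have hq0 : q ≠ 0 := by
    rintro rfl
    have := ha D.toReal
    simp only [map_mul, ← hn, map_zero, zero_mul, lt_irrefl] at this
  obtain ⟨v, rfl⟩ := D.exists_sq_of_totallyPositive u fun k => by
    have h := ha (D.emb k)
    simp only [map_mul, ← hn] at h
    exact pos_of_mul_pos_right h (toReal_normSq_pos _ hq0).le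
  refine ⟨((v : 𝓞 K) : K) • q, smul_mem_hurwitzOrder _ hq, ?_⟩
  simp only [Quaternion.normSq_smul, hn, map_mul, Units.val_pow_eq_pow_val, map_pow, mul_comm]

end HeptagonalField

/-! ### The two forms and their equivalence -/

namespace HeptagonalField
open UniversalForm
variable {K : Type*} [Field K] [NumberField K]

theorem aeval_quaternionForm {R A : Type*} [CommRing R] [CommRing A] [Algebra R A]
    (x : Fin 4 → A) : MvPolynomial.aeval x (quaternionForm R) = x 0 ^ 2 + x 0 * x 1 + x 1 ^ 2 +
      x 1 * x 2 - x 0 * x 3 + x 2 ^ 2 + x 2 * x 3 + x 3 ^ 2 := by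
  simp [quaternionForm]

theorem aeval_hurwitzForm {R A : Type*} [CommRing R] [CommRing A] [Algebra R A]
    (x : Fin 4 → A) : MvPolynomial.aeval x (hurwitzForm R) = x 0 ^ 2 + x 1 ^ 2 + x 2 ^ 2 +
      x 3 ^ 2 + x 0 * x 1 + x 0 * x 2 + x 0 * x 3 := by
  simp [hurwitzForm]

/-- The change of variables that takes `quaternionForm` to `hurwitzForm`. -/
def changeOfVariables (R : Type*) [CommRing R] : (Fin 4 → R) ≃ (Fin 4 → R) where
  toFun v := ![2 * v 0 + v 1 - v 3, -v 0, -v 0 + v 2 + v 3, -v 0 + v 3]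
  invFun v := ![-v 1, v 0 + v 1 + v 3, v 2 - v 3, v 3 - v 1]
  left_inv v := by ext i; fin_cases i <;> simp; ring
  right_inv v := by ext i; fin_cases i <;> simp <;> ring

theorem aeval_changeOfVariables {R A : Type*} [CommRing R] [CommRing A] [Algebra R A]
    (x : Fin 4 → A) : MvPolynomial.aeval (changeOfVariables A x) (hurwitzForm R) =
      MvPolynomial.aeval x (quaternionForm R) := by
  rw [aeval_hurwitzForm, aeval_quaternionForm]
  simp [changeOfVariables]
  ring

theorem eval_changeOfVariables {R : Type*} [CommRing R] (x : Fin 4 → R) :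
    MvPolynomial.eval (changeOfVariables R x) (hurwitzForm R) =
      MvPolynomial.eval x (quaternionForm R) := by
  rw [← MvPolynomial.coe_aeval_eq_eval, ← MvPolynomial.coe_aeval_eq_eval]
  exact aeval_changeOfVariables x

theorem isHomogeneous_quaternionForm (R : Type*) [CommRing R] :
    (quaternionForm R).IsHomogeneous 2 := by
  have h (i j : Fin 4) : (MvPolynomial.X i * MvPolynomial.X j : MvPolynomial _ R).IsHomogeneous 2 :=
    (MvPolynomial.isHomogeneous_X R i).mul (MvPolynomial.isHomogeneous_X R j)
  simp only [quaternionForm, pow_two]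
  exact (((((((h 0 0).add (h 0 1)).add (h 1 1)).add (h 1 2)).sub (h 0 3)).add (h 2 2)).add
    (h 2 3)).add (h 3 3)

theorem isHomogeneous_hurwitzForm (R : Type*) [CommRing R] :
    (hurwitzForm R).IsHomogeneous 2 := by
  have h (i j : Fin 4) : (MvPolynomial.X i * MvPolynomial.X j : MvPolynomial _ R).IsHomogeneous 2 :=
    (MvPolynomial.isHomogeneous_X R i).mul (MvPolynomial.isHomogeneous_X R j)
  simp only [hurwitzForm, pow_two]
  exact ((((((h 0 0).add (h 1 1)).add (h 2 2)).add (h 3 3)).add (h 0 1)).add (h 0 2)).add (h 0 3)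

theorem totallyPositiveDefinite_quaternionForm :
    TotallyPositiveDefinite (K := K) (quaternionForm (𝓞 K)) := by
  intro x hx σ
  have h : MvPolynomial.aeval x (quaternionForm (𝓞 K)) = Quaternion.normSq
      (quat (x 0 + (x 1 - x 3) / 2) ((x 1 - x 3) / 2) (x 2 + (x 1 + x 3) / 2)
        ((x 1 + x 3) / 2)) := by
    rw [normSq_quat, aeval_quaternionForm]
    ring
  rw [h]
  refine toReal_normSq_pos σ fun h0 => hx ?_
  have h1 := congrArg QuaternionAlgebra.re h0
  have h2 := congrArg QuaternionAlgebra.imI h0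
  have h3 := congrArg QuaternionAlgebra.imJ h0
  have h4 := congrArg QuaternionAlgebra.imK h0
  simp only [re_quat, imI_quat, imJ_quat, imK_quat, Quaternion.re_zero, Quaternion.imI_zero,
    Quaternion.imJ_zero, Quaternion.imK_zero] at h1 h2 h3 h4
  ext i
  fin_cases i
  · change x 0 = 0; linear_combination h1 - h2
  · change x 1 = 0; linear_combination h2 + h4
  · change x 2 = 0; linear_combination h3 - h4
  · change x 3 = 0; linear_combination h4 - h2

theorem isUniversal_quaternionForm (D : HeptagonalField K) :
    IsUniversal (quaternionForm (𝓞 K)) := by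
  refine ⟨isHomogeneous_quaternionForm _, totallyPositiveDefinite_quaternionForm, fun a ha => ?_⟩
  obtain ⟨_, ⟨x, y, z, w, rfl⟩, h⟩ := D.exists_normSq_eq_of_totallyPositive ha
  rw [normSq_hurwitzMk] at h
  refine ⟨![x, y, z, w], ?_⟩
  rw [← MvPolynomial.coe_aeval_eq_eval]
  exact (aeval_quaternionForm _).trans (NumberField.RingOfIntegers.ext h)

theorem isUniversal_hurwitzForm (D : HeptagonalField K) : IsUniversal (hurwitzForm (𝓞 K)) := by
  refine ⟨isHomogeneous_hurwitzForm _, fun x hx => ?_, fun a ha => ?_⟩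
  · obtain ⟨y, rfl⟩ := (changeOfVariables K).surjective x
    rw [aeval_changeOfVariables]
    refine totallyPositiveDefinite_quaternionForm y fun hy => hx ?_
    rw [hy]
    ext i
    fin_cases i <;> simp [changeOfVariables]
  · obtain ⟨x, hx⟩ := D.isUniversal_quaternionForm.2.2 a ha
    exact ⟨changeOfVariables _ x, (eval_changeOfVariables x).trans hx⟩

/-! ### The order inside the real quaternions -/

/-- The embedding of quaternions over `K` into the real quaternions that takes
`(1 + i + j + k) / 2` and `j` to `alpha` and `beta`. -/
noncomputable def toRealQuaternion (σ : K →+* ℝ) : ℍ[K] →+* ℍ[ℝ] :=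
  letI := σ.toAlgebra
  have h2 : √2 ^ 2 = 2 := Real.sq_sqrt (by norm_num)
  have h3 : √3 ^ 2 = 3 := Real.sq_sqrt (by norm_num)
  -- The triple is determined by `j ↦ β`, `i + j + k ↦ 2α - 1 = √3 i` and `ij = k`.
  let B : QuaternionAlgebra.Basis ℍ[ℝ] (-1 : K) 0 (-1) :=
    { i := quat 0 (√3 / 3) (-(√2 * √3) / 6) (-√2 / 2)
      j := quat 0 (√3 / 3) (√2 * √3 / 3) 0
      k := quat 0 (√3 / 3) (-(√2 * √3) / 6) (√2 / 2)
      i_mul_i := by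
        rw [zero_smul, neg_one_smul]
        ext <;> simp <;> grind
      j_mul_j := by
        rw [neg_one_smul]
        ext <;> simp <;> grind
      i_mul_j := by
        ext <;> simp <;> grind
      j_mul_i := by
        rw [zero_smul]
        ext <;> simp <;> grind }
  B.liftHom.toRingHom

theorem toRealQuaternion_apply (σ : K →+* ℝ) (q : ℍ[K]) : toRealQuaternion σ q = quat (σ q.re) 0 0 0 +
    σ q.imI • quat 0 (√3 / 3) (-(√2 * √3) / 6) (-√2 / 2) +
    σ q.imJ • quat 0 (√3 / 3) (√2 * √3 / 3) 0 +
    σ q.imK • quat 0 (√3 / 3) (-(√2 * √3) / 6) (√2 / 2) :=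
  rfl

theorem toRealQuaternion_hurwitzMk (σ : K →+* ℝ) (x y z w : 𝓞 K) :
    toRealQuaternion σ (hurwitzMk x y z w) =
      ((σ x : ℝ) : ℍ[ℝ]) + ((σ y : ℝ) : ℍ[ℝ]) * alpha 1 1 + ((σ z : ℝ) : ℍ[ℝ]) * beta 1 1 1 1 +
        ((σ w : ℝ) : ℍ[ℝ]) * (alpha 1 1 * beta 1 1 1 1) := by
  have h2 : √2 ^ 2 = 2 := Real.sq_sqrt (by norm_num)
  have h3 : √3 ^ 2 = 3 := Real.sq_sqrt (by norm_num)
  have hα : alpha 1 1 = quat (1 / 2) (√3 / 2) 0 0 := by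
    ext <;> norm_num [alpha]
  have hβ : beta 1 1 1 1 = quat 0 (√3 / 3) (√2 * √3 / 3) 0 := by
    have h1 : (√3)⁻¹ = √3 / 3 := by grind
    ext <;> norm_num [beta, h1]
    rw [div_eq_mul_inv, h1, mul_div_assoc]
  rw [toRealQuaternion_apply, hα, hβ]
  ext <;> simp [map_ofNat] <;> grind

theorem isQuaternionPID_quaternionSet (D : HeptagonalField K) (σ : K →+* ℝ) :
    IsQuaternionPID (quaternionSet σ 1 1 1 1) := by
  have := D.isPrincipalIdealRing_hurwitzOrder
  let R := (hurwitzOrder K).map (toRealQuaternion σ)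
  let f : hurwitzOrder K →+* R := (toRealQuaternion σ).restrict (hurwitzOrder K) R
    fun q hq => ⟨q, hq, rfl⟩
  have hf : Function.Surjective f := by
    rintro ⟨_, q, hq, rfl⟩
    exact ⟨⟨q, hq⟩, rfl⟩
  -- Conjugation is an anti-automorphism of the order, so the opposite ring is also a quotient of
  -- it.
  let g : hurwitzOrder K →+* Rᵐᵒᵖ :=
    { toFun q := .op (f ⟨star q, star_mem_hurwitzOrder q.2⟩)
      map_one' := by
        rw [← MulOpposite.op_one, ← map_one f]
        congr 2
        exact Subtype.ext (star_one _)
      map_mul' p q := by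
        rw [← MulOpposite.op_mul, ← map_mul f]
        congr 2
        exact Subtype.ext (star_mul _ _)
      map_zero' := by
        rw [← MulOpposite.op_zero, ← map_zero f]
        congr 2
        exact Subtype.ext (star_zero _)
      map_add' p q := by
        rw [← MulOpposite.op_add, ← map_add f]
        congr 2
        exact Subtype.ext (star_add _ _) }
  have hg : Function.Surjective g := by
    rintro ⟨_, q, hq, rfl⟩
    exact ⟨⟨star q, star_mem_hurwitzOrder hq⟩, MulOpposite.unop_injective
      (Subtype.ext (congrArg (toRealQuaternion σ) (star_star q)))⟩
  refine ⟨R, ?_, inferInstance, .of_surjective f hf, .of_surjective g hg⟩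
  ext L
  have h1 : σ ((1 : 𝓞 K) : K) = 1 := by simp
  simp only [quaternionSet, h1, ← toRealQuaternion_hurwitzMk]
  constructor
  · rintro ⟨_, ⟨x, y, z, w, rfl⟩, rfl⟩
    exact ⟨x, y, z, w, rfl⟩
  · rintro ⟨x, y, z, w, rfl⟩
    exact ⟨_, hurwitzMk_mem x y z w, rfl⟩

end HeptagonalField

/-! ### The field generated by `ζ + ζ⁻¹` -/

section Cubic

open Polynomial

/-- The minimal polynomial of `ζ + ζ⁻¹` for a primitive seventh root of unity `ζ`. -/
noncomputable def heptagonalPoly : ℚ[X] := X ^ 3 + X ^ 2 - 2 * X - 1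

theorem aeval_heptagonalPoly {A : Type*} [CommRing A] [Algebra ℚ A] (x : A) :
    aeval x heptagonalPoly = x ^ 3 + x ^ 2 - 2 * x - 1 := by
  simp [heptagonalPoly, map_ofNat]

theorem natDegree_heptagonalPoly : heptagonalPoly.natDegree = 3 := by
  unfold heptagonalPoly
  compute_degree!

theorem monic_heptagonalPoly : heptagonalPoly.Monic := by
  unfold heptagonalPoly
  monicity!

/-- A rational root would be an integer dividing 1, and `±1` are not roots. -/
theorem irreducible_heptagonalPoly : Irreducible heptagonalPoly := by
  refine (irreducible_iff_roots_eq_zero_of_degree_le_three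
    (by rw [natDegree_heptagonalPoly]; norm_num)
    (by rw [natDegree_heptagonalPoly])).2 (Multiset.eq_zero_of_forall_notMem fun r hr => ?_)
  have hr : r ^ 3 + r ^ 2 - 2 * r - 1 = 0 := by
    rw [← aeval_heptagonalPoly, coe_aeval_eq_eval]
    exact (mem_roots'.1 hr).2
  have hint : IsIntegral ℤ r := by
    refine ⟨X ^ 3 + X ^ 2 - 2 * X - 1, by monicity!, ?_⟩
    rw [← aeval_def]
    simpa [map_ofNat] using hr
  obtain ⟨n, rfl⟩ := IsIntegrallyClosed.isIntegral_iff.1 hint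
  simp only [eq_intCast] at hr
  norm_cast at hr
  have hn : IsUnit n := .of_mul_eq_one (n ^ 2 + n - 2) (by linear_combination hr)
  rcases Int.isUnit_iff.1 hn with rfl | rfl <;> norm_num at hr

theorem HeptagonalField.nonempty_of_powerBasis {K : Type*} [Field K] [CharZero K] [Algebra ℚ K]
    (pb : PowerBasis ℚ K) (hmin : minpoly ℚ pb.gen = heptagonalPoly) {r : ℝ}
    (hr : r ^ 3 + r ^ 2 - 2 * r - 1 = 0) : Nonempty (HeptagonalField K) := by
  have hroot : pb.gen ^ 3 + pb.gen ^ 2 - 2 * pb.gen - 1 = 0 := by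
    rw [← aeval_heptagonalPoly, ← hmin, minpoly.aeval]
  -- Squaring `ζ` sends `ζ + ζ⁻¹` to its square minus 2, which is the Galois conjugation.
  have hconj : aeval (pb.gen ^ 2 - 2) (minpoly ℚ pb.gen) = 0 := by
    rw [hmin, aeval_heptagonalPoly]
    linear_combination (pb.gen ^ 3 - pb.gen ^ 2 - 2 * pb.gen + 1) * hroot
  have hreal : aeval r (minpoly ℚ pb.gen) = 0 := by rw [hmin, aeval_heptagonalPoly, hr]
  refine ⟨⟨pb.gen, hroot, fun x => ?_, pb.lift _ hconj, pb.lift_gen _ hconj, pb.lift r hreal⟩⟩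
  obtain ⟨f, hf, rfl⟩ := pb.exists_eq_aeval x
  rw [← pb.natDegree_minpoly, hmin, natDegree_heptagonalPoly] at hf
  refine ⟨f.coeff 0, f.coeff 1, f.coeff 2, ?_⟩
  rw [aeval_eq_sum_range' hf]
  simp [Finset.sum_range_succ, Algebra.smul_def]

end Cubic

section RootOfUnity

variable {ζ : ℂ} (hζ : IsPrimitiveRoot ζ 7)
include hζ

/-- Multiplying the value by `ζ³` gives `1 + ζ + ⋯ + ζ⁶`. -/
theorem IsPrimitiveRoot.aeval_heptagonalPoly :
    Polynomial.aeval (ζ + ζ⁻¹) heptagonalPoly = 0 := by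
  have h0 : ζ ≠ 0 := hζ.ne_zero (by norm_num)
  have h := hζ.geom_sum_eq_zero (by norm_num)
  simp only [Finset.sum_range_succ, Finset.sum_range_zero] at h
  rw [_root_.aeval_heptagonalPoly]
  field_simp
  linear_combination h

theorem IsPrimitiveRoot.minpoly_add_inv : minpoly ℚ (ζ + ζ⁻¹) = heptagonalPoly :=
  (minpoly.eq_of_irreducible_of_monic irreducible_heptagonalPoly hζ.aeval_heptagonalPoly
    monic_heptagonalPoly).symm

theorem IsPrimitiveRoot.isIntegral_add_inv : IsIntegral ℚ (ζ + ζ⁻¹) :=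
  ⟨_, monic_heptagonalPoly, hζ.aeval_heptagonalPoly⟩

theorem IsPrimitiveRoot.exists_real_eq_add_inv : ∃ r : ℝ, ζ + ζ⁻¹ = r :=
  ⟨2 * ζ.re, by
    rw [Complex.inv_eq_conj (hζ.norm'_eq_one (by norm_num)), Complex.add_conj]⟩

theorem IsPrimitiveRoot.numberField_adjoin_add_inv : NumberField ℚ⟮ζ + ζ⁻¹⟯ where
  to_finiteDimensional := IntermediateField.adjoin.finiteDimensional hζ.isIntegral_add_inv

theorem IsPrimitiveRoot.nonempty_heptagonalField : Nonempty (HeptagonalField ℚ⟮ζ + ζ⁻¹⟯) := by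
  obtain ⟨r, hr⟩ := hζ.exists_real_eq_add_inv
  refine HeptagonalField.nonempty_of_powerBasis
    (IntermediateField.adjoin.powerBasis hζ.isIntegral_add_inv) (r := r) ?_ ?_
  · rw [IntermediateField.adjoin.powerBasis_gen, IntermediateField.minpoly_gen, hζ.minpoly_add_inv]
  · have h := hζ.aeval_heptagonalPoly
    rw [_root_.aeval_heptagonalPoly, hr] at h
    exact_mod_cast h

end RootOfUnity

theorem mainTheorem1 (ζ : ℂ) (hζ : IsPrimitiveRoot ζ 7) :
    -- both forms are universal over `ℚ(ζ + ζ⁻¹)`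
    UniversalForm.IsUniversal (UniversalForm.quaternionForm (𝓞 ℚ⟮ζ + ζ⁻¹⟯)) ∧
    UniversalForm.IsUniversal (UniversalForm.hurwitzForm (𝓞 ℚ⟮ζ + ζ⁻¹⟯)) ∧
    -- the two forms are related by an explicit invertible change of variables
    (Function.Bijective (fun v : Fin 4 → 𝓞 ℚ⟮ζ + ζ⁻¹⟯ =>
        (![2 * v 0 + v 1 - v 3, -v 0, -v 0 + v 2 + v 3, -v 0 + v 3] : Fin 4 → 𝓞 ℚ⟮ζ + ζ⁻¹⟯)) ∧
      ∀ v : Fin 4 → 𝓞 ℚ⟮ζ + ζ⁻¹⟯,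
        MvPolynomial.eval
            (![2 * v 0 + v 1 - v 3, -v 0, -v 0 + v 2 + v 3, -v 0 + v 3] : Fin 4 → 𝓞 ℚ⟮ζ + ζ⁻¹⟯)
            (UniversalForm.hurwitzForm (𝓞 ℚ⟮ζ + ζ⁻¹⟯)) =
          MvPolynomial.eval v (UniversalForm.quaternionForm (𝓞 ℚ⟮ζ + ζ⁻¹⟯))) ∧
    -- the quaternion ring with `(A, B, μ, ν) = (1, 1, 1, 1)` is a principal ideal domain
    (∀ σ : ℚ⟮ζ + ζ⁻¹⟯ →+* ℝ,
      UniversalForm.IsQuaternionPID (UniversalForm.quaternionSet σ 1 1 1 1)) := by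
  have := hζ.numberField_adjoin_add_inv
  obtain ⟨D⟩ := hζ.nonempty_heptagonalField
  exact ⟨D.isUniversal_quaternionForm, D.isUniversal_hurwitzForm,
    ⟨(HeptagonalField.changeOfVariables _).bijective, HeptagonalField.eval_changeOfVariables⟩,
    D.isQuaternionPID_quaternionSet⟩
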